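/- Let $G_k$ be the free product of $k+1$ cyclic groups of order two with generators $a_1,\dots,a_{k+1}$. The Cayley tree of order $k$ has vertex set $V=G_k$, with $x$ and $y$ nearest neighbours iff $y=xa_i$ for some $i$. Let $x^0=1$ be its root, $d$ the graph distance, $W_n=\{x: d(x,x^0)=n\}$ and $V_n=\bigcup_{j\le n}W_j$. Let $G_k^{(2)}\subset G_k$ be the subgroup of elements of even word length. A configuration $\sigma\in\{0,1\}^V$ is admissible if $\sigma(x)\sigma(y)=0$ for all nearest neighbours $x,y$; $\Omega$ is the set of admissible configurations with the $\sigma$-algebra generated by cylinders, and $\Omega_{V_n}$ is the set of admissible configurations on $V_n$. For $\sigma_n\in\Omega_{V_n}$ let $\#\sigma_n$ be the number of vertices $x\in V_n$ with $\sigma_n(x)=1$. For $\lambda>0$, a hard-core Gibbs measure is a probability measure $\mu$ on $\Omega$ such that for all $n\ge 0$ and $\sigma_n\in\Omega_{V_n}$ $$\mu\{\sigma|_{V_n}=\sigma_n\}=\int_\Omega \frac{\lambda^{\#\sigma_n}\mathbf 1(\sigma_n\vee\omega|_{W_{n+1}}\in\Omega_{V_{n+1}})}{\sum_{\tau_n\in\Omega_{V_n}}\lambda^{\#\tau_n}\mathbf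 1(\tau_n\vee\omega|_{W_{n+1}}\in\Omega_{V_{n+1}})}\,\mu(d\omega).$$ It is extreme if it is an extreme point of the convex set of all hard-core Gibbs measures with the same $\lambda$. A probability measure $\mu$ on $\Omega$ corresponds to a positive collection $z=\{z_x\}_{x\in V}$ if, for all $n\ge1$ and $\sigma_n\in\Omega_{V_n}$, $\mu\{\sigma|_{V_n}=\sigma_n\}=\frac1{Z_n}\lambda^{\#\sigma_n}\prod_{x\in W_n}z_{\sigma_n(x),x}$, where $z_{0,x}=1$, $z_{1,x}=z_x$ and $Z_n$ is the normalising constant. For a subgroup $H\le G_k$, $\mu$ is $H$-periodic if it corresponds to a positive collection with $z_{yx}=z_x$ for all $x\in G_k$, $y\in H$; it is translation-invariant if it is $G_k$-periodic. **Theorem.** Let $k=3$ and $\lambda>\frac{27}{16}$. Put $$a=\frac16\sqrt[3]{\frac{12\sqrt{12\lambda+81}+8\lambda+108}{\lambda}}+\frac23\sqrt[3]{\frac{\lambda}{12\sqrt{12\lambda+81}+8\lambda+108}}+\frac13,\qquad z_{1,2}=\left(\frac{\lambda a^2\mp\sqrt{\lambda^2a^4-4\lambda a}}{2\lambda a}\right)^3,$$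 with the sign $-$ for $z_1$ and $+$ for $z_2$. Then $a^3-a^2-\frac1\lambda=0$, $0<z_1<z_2$, $z_1=(1+\lambda z_2)^{-3}$, $z_2=(1+\lambda z_1)^{-3}$, and $$g(\lambda)=9\cdot\frac{\lambda^2z_1z_2}{(1+\lambda z_1)(1+\lambda z_2)}\cdot\frac{\lambda}{\lambda+1}-1<0.$$ Moreover, there exist hard-core Gibbs measures $\mu^{(1)}\ne\mu^{(2)}$ such that $\mu^{(1)}$ corresponds to the collection equal to $z_1$ on $G_3^{(2)}$ and to $z_2$ on $G_3\setminus G_3^{(2)}$, and $\mu^{(2)}$ corresponds to the collection with $z_1$ and $z_2$ interchanged. These two measures are exactly the $G_3^{(2)}$-periodic measures that are not translation-invariant, and both are extreme. -/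

import Mathlib

noncomputable section

namespace HardCore

open MeasureTheory
open scoped NNReal ENNReal Classical

/-! ### The Cayley tree of order `k` -/

/-- The group `G_k`: the free product of `k + 1` cyclic groups of order two. Its elements are the
vertices of the Cayley tree of order `k`; the root `x⁰` is the identity. -/
abbrev Vertex (k : ℕ) : Type :=
  Monoid.CoprodI (fun _ : Fin (k + 1) => Multiplicative (ZMod 2))

/-- The generators `a_1, …, a_{k+1}` of `G_k`. -/
def gen (k : ℕ) (i : Fin (k + 1)) : Vertex k :=
  Monoid.CoprodI.of (i := i) (Multiplicative.ofAdd (1 : ZMod 2))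

/-- The Cayley tree of order `k`: the right Cayley graph of `G_k`, in which the neighbours of `x`
are `x * a_1, …, x * a_{k+1}`. -/
def tree (k : ℕ) : SimpleGraph (Vertex k) :=
  SimpleGraph.mulCayley (Set.range (gen k))

theorem gen_mul_self (k : ℕ) (i : Fin (k + 1)) : gen k i * gen k i = 1 := by
  have h : (Multiplicative.ofAdd (1 : ZMod 2)) * Multiplicative.ofAdd (1 : ZMod 2) = 1 := by decide
  rw [gen, ← map_mul, h, map_one]

theorem gen_ne_one (k : ℕ) (i : Fin (k + 1)) : gen k i ≠ 1 := by
  intro h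
  have h2 := Monoid.CoprodI.of_injective (M := fun _ : Fin (k + 1) => Multiplicative (ZMod 2)) i
    (h.trans (map_one _).symm)
  exact absurd h2 (by decide)

theorem tree_adj (k : ℕ) (x y : Vertex k) : (tree k).Adj x y ↔ ∃ i, y = x * gen k i := by
  rw [tree, SimpleGraph.mulCayley_adj']
  constructor
  · rintro ⟨-, _, ⟨i, rfl⟩, h | h⟩
    · exact ⟨i, h.symm⟩
    · exact ⟨i, by rw [h, mul_assoc, gen_mul_self, mul_one]⟩
  · rintro ⟨i, rfl⟩
    refine ⟨?_, gen k i, ⟨i, rfl⟩, Or.inl rfl⟩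
    intro h
    exact gen_ne_one k i (mul_eq_left.mp h.symm)

theorem tree_connected (k : ℕ) : (tree k).Connected := by
  have step : ∀ x : Vertex k, (tree k).Reachable 1 x := by
    intro x
    induction x using Monoid.CoprodI.induction_left with
    | one => exact SimpleGraph.Reachable.refl _
    | @mul i m x ih =>
      have left : ∀ g u v : Vertex k, (tree k).Reachable u v →
          (tree k).Reachable (g * u) (g * v) := by
        intro g u v h
        refine h.map (G' := tree k) ⟨fun x => g * x, ?_⟩
        intro a b hab
        obtain ⟨j, rfl⟩ := (tree_adj k a b).mp hab
        exact (tree_adj k _ _).mpr ⟨j, (mul_assoc _ _ _).symm⟩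
      have h1 : (tree k).Reachable 1 (Monoid.CoprodI.of (i := i) m : Vertex k) := by
        by_cases hm : m = 1
        · subst hm
          rw [map_one]
        · have hm' : m = Multiplicative.ofAdd (1 : ZMod 2) := by
            revert hm; revert m; decide
          subst hm'
          exact ((tree_adj k _ _).mpr ⟨i, by rw [one_mul]; rfl⟩).reachable
      have h2 := left (Monoid.CoprodI.of (i := i) m) 1 x ih
      rw [mul_one] at h2
      exact h1.trans h2
  have : Nonempty (Vertex k) := ⟨1⟩
  exact ⟨fun x y => (step x).symm.trans (step y)⟩

/-- `V_n`, the vertices at distance at most `n` from the root. -/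
def ball (k n : ℕ) : Set (Vertex k) := {x | (tree k).dist 1 x ≤ n}

/-- `W_n`, the vertices at distance exactly `n` from the root. -/
def sphere (k n : ℕ) : Set (Vertex k) := {x | (tree k).dist 1 x = n}

theorem ball_finite (k n : ℕ) : (ball k n).Finite := by
  have key : ∀ n : ℕ, {x : Vertex k | ∃ p : (tree k).Walk x 1, p.length ≤ n}.Finite := by
    intro n
    induction n with
    | zero =>
      refine (Set.finite_singleton (1 : Vertex k)).subset ?_
      rintro x ⟨p, hp⟩
      exact SimpleGraph.Walk.eq_of_length_eq_zero (Nat.le_zero.mp hp)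
    | succ n ih =>
      refine ((Set.finite_singleton (1 : Vertex k)).union
        (Set.finite_iUnion fun i : Fin (k + 1) => ih.image fun y => y * gen k i)).subset ?_
      rintro x ⟨p, hp⟩
      cases p with
      | nil => exact Or.inl rfl
      | @cons _ y _ h q =>
        right
        obtain ⟨i, rfl⟩ := (tree_adj k _ _).mp h
        refine Set.mem_iUnion.mpr ⟨i, x * gen k i, ⟨q, ?_⟩, ?_⟩
        · simpa using hp
        · simp only [mul_assoc, gen_mul_self, mul_one]
  refine (key n).subset ?_
  intro x hx
  obtain ⟨p, hp⟩ := (tree_connected k).exists_walk_length_eq_dist 1 x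
  exact ⟨p.reverse, by rw [SimpleGraph.Walk.length_reverse, hp]; exact hx⟩

instance (k n : ℕ) : Fintype (ball k n) := (ball_finite k n).fintype

/-- The word length `|x|`: the number of letters in the reduced word of `x`. -/
def wordLength (k : ℕ) (x : Vertex k) : ℕ := (Monoid.CoprodI.Word.equiv x).toList.length

/-- The homomorphism `G_k → ℤ/2` sending every generator to `1`. -/
def parity (k : ℕ) : Vertex k →* Multiplicative (ZMod 2) :=
  Monoid.CoprodI.lift fun _ => MonoidHom.id _

/-- `G_k^{(2)}`, the normal subgroup of index two of the elements of even word length; see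
`mem_evenSubgroup`. -/
def evenSubgroup (k : ℕ) : Subgroup (Vertex k) := (parity k).ker

theorem mem_evenSubgroup (k : ℕ) (x : Vertex k) :
    x ∈ evenSubgroup k ↔ Even (wordLength k x) := by
  have main : ∀ l : List (Σ _ : Fin (k + 1), Multiplicative (ZMod 2)), (∀ s ∈ l, s.2 ≠ 1) →
      (parity k (l.map fun s => Monoid.CoprodI.of (i := s.1) s.2).prod = 1 ↔ Even l.length) := by
    intro l
    induction l with
    | nil => simp
    | cons s l ih =>
      intro hl
      have hs : s.2 = Multiplicative.ofAdd (1 : ZMod 2) := by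
        have := hl s (by simp)
        revert this
        generalize s.2 = m
        revert m
        decide
      have h1 := ih fun t ht => hl t (by simp [ht])
      have hp : parity k (Monoid.CoprodI.of (i := s.1) s.2)
          = Multiplicative.ofAdd (1 : ZMod 2) := by
        rw [parity, Monoid.CoprodI.lift_of, hs]; rfl
      rw [List.map_cons, List.prod_cons, map_mul, hp, List.length_cons, Nat.even_add_one,
        ← h1]
      generalize parity k (l.map fun s => Monoid.CoprodI.of (i := s.1) s.2).prod = m
      revert m
      decide
  have hx : x = ((Monoid.CoprodI.Word.equiv x).toList.map
      fun s => Monoid.CoprodI.of (i := s.1) s.2).prod :=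
    (Monoid.CoprodI.Word.equiv.symm_apply_apply x).symm
  rw [evenSubgroup, MonoidHom.mem_ker]
  conv_lhs => rw [hx]
  exact (main _ (Monoid.CoprodI.Word.equiv x).ne_one)

/-! ### Admissible configurations -/

/-- `Ω`, the set of admissible configurations `σ : V → {0, 1}`: `σ(x) σ(y) = 0` for all nearest
neighbours. As a subtype of a product space it carries the σ-algebra generated by cylinders. -/
abbrev Config (k : ℕ) : Type :=
  {σ : Vertex k → Fin 2 // ∀ x y, (tree k).Adj x y → σ x * σ y = 0}

/-- Admissibility of a configuration on a set `A` of vertices. -/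
def IsAdmissible {k : ℕ} {A : Set (Vertex k)} (σ : A → Fin 2) : Prop :=
  ∀ x y : A, (tree k).Adj x y → σ x * σ y = 0

/-- `Ω_{V_n}`, the set of admissible configurations on `V_n`. -/
abbrev LocalConfig (k n : ℕ) : Type := {σ : ball k n → Fin 2 // IsAdmissible σ}

/-- The cylinder `{σ ∈ Ω : σ|_{V_n} = σ_n}`. -/
def cylinder {k n : ℕ} (σn : LocalConfig k n) : Set (Config k) :=
  {σ | ∀ x : ball k n, σ.1 x = σn.1 x}

/-- `#σ_n`, the number of occupied vertices. -/
def numOccupied {k n : ℕ} (σn : LocalConfig k n) : ℕ :=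
  (Finset.univ.filter fun x : ball k n => σn.1 x = 1).card

/-! ### Hard-core Gibbs measures -/

/-- The configuration `σ_n ∨ ω|_{W_{n+1}}` on `V_{n+1}`. -/
def join {k n : ℕ} (σn : LocalConfig k n) (ω : Config k) : ball k (n + 1) → Fin 2 :=
  fun x => if h : (x : Vertex k) ∈ ball k n then σn.1 ⟨x, h⟩ else ω.1 x

/-- The unnormalised weight `e^{-H(σ_n)} 1(σ_n ∨ ω|_{W_{n+1}} ∈ Ω_{V_{n+1}})`, where
`e^{-H(σ_n)} = λ^{#σ_n}`. -/
def boundaryWeight {k n : ℕ} (lam : ℝ) (σn : LocalConfig k n) (ω : Config k) : ℝ :=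
  if IsAdmissible (join σn ω) then lam ^ numOccupied σn else 0

/-- The conditional probability `P_n(σ_n | ω|_{W_{n+1}})`. -/
def condProb {k n : ℕ} (lam : ℝ) (σn : LocalConfig k n) (ω : Config k) : ℝ :=
  boundaryWeight lam σn ω / ∑ τ : LocalConfig k n, boundaryWeight lam τ ω

/-- `μ` is a hard-core Gibbs measure with activity `λ`: a probability measure on `Ω` with
`μ(σ|_{V_n} = σ_n) = ∫ P_n(σ_n | ω|_{W_{n+1}}) μ(dω)` for all `n` and `σ_n ∈ Ω_{V_n}`. -/
def IsGibbs {k : ℕ} (lam : ℝ) (μ : Measure (Config k)) : Prop :=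
  IsProbabilityMeasure μ ∧
    ∀ (n : ℕ) (σn : LocalConfig k n),
      μ (cylinder σn) = ∫⁻ ω, ENNReal.ofReal (condProb lam σn ω) ∂μ

/-- `μ` is an extreme Gibbs measure: an extreme point of the convex set of all hard-core Gibbs
measures with activity `λ`. -/
def IsExtremeGibbs {k : ℕ} (lam : ℝ) (μ : Measure (Config k)) : Prop :=
  μ ∈ Set.extremePoints ℝ≥0 {ν : Measure (Config k) | IsGibbs lam ν}

/-! ### Gibbs measures corresponding to a collection `z` -/

/-- The weight `λ^{#σ_n} ∏_{x ∈ W_n} z_{σ(x),x}` for a vector-valued function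
`x ↦ z_x = (z_{0,x}, z_{1,x})`. -/
def finiteWeight {k n : ℕ} (lam : ℝ) (z : Vertex k → Fin 2 → ℝ) (σn : LocalConfig k n) : ℝ :=
  lam ^ numOccupied σn *
    ∏ x ∈ Finset.univ.filter (fun x : ball k n => (x : Vertex k) ∈ sphere k n), z x (σn.1 x)

/-- The finite-volume probability `μ^{(n)}(σ_n)`. -/
def finiteProb {k n : ℕ} (lam : ℝ) (z : Vertex k → Fin 2 → ℝ) (σn : LocalConfig k n) : ℝ :=
  finiteWeight lam z σn / ∑ τ : LocalConfig k n, finiteWeight lam z τ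

/-- `μ` corresponds to the collection `z_x` (that is, to the vectors `(1, z_x)`): it is a
probability measure on `Ω` with `μ(σ|_{V_n} = σ_n) = μ^{(n)}(σ_n)` for all `n ≥ 1`. The
consistency of the `μ^{(n)}` is implied by the existence of `μ`. The value of `z` at the root is
irrelevant. -/
def CorrespondsTo {k : ℕ} (lam : ℝ) (z : Vertex k → ℝ) (μ : Measure (Config k)) : Prop :=
  IsProbabilityMeasure μ ∧
    ∀ (n : ℕ), 1 ≤ n → ∀ σn : LocalConfig k n,
      μ (cylinder σn) = ENNReal.ofReal (finiteProb lam (fun x => ![1, z x]) σn)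

/-- The collection `z` is `H`-periodic: `z_{yx} = z_x` for all `x ∈ G_k` and `y ∈ H`. -/
def IsPeriodic {k : ℕ} (H : Subgroup (Vertex k)) (z : Vertex k → ℝ) : Prop :=
  ∀ x : Vertex k, ∀ y ∈ H, z (y * x) = z x

/-- `μ` is `H`-periodic: it corresponds to a positive `H`-periodic collection. -/
def IsPeriodicMeasure {k : ℕ} (lam : ℝ) (H : Subgroup (Vertex k)) (μ : Measure (Config k)) :
    Prop :=
  ∃ z : Vertex k → ℝ, (∀ x, 0 < z x) ∧ IsPeriodic H z ∧ CorrespondsTo lam z μ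

/-- `μ` is translation-invariant: it is `G_k`-periodic. -/
def IsTranslationInvariant {k : ℕ} (lam : ℝ) (μ : Measure (Config k)) : Prop :=
  IsPeriodicMeasure lam ⊤ μ

/-- The collection equal to `u` on `G_k^{(2)}` and to `v` on its complement. -/
def twoValued (k : ℕ) (u v : ℝ) : Vertex k → ℝ :=
  fun x => if x ∈ evenSubgroup k then u else v

/-! ### The explicit solution for `k = 3` -/

/-- The real number `a` given by Cardano's formula for `a³ - a² - 1/λ = 0`. -/
def cardanoRoot (lam : ℝ) : ℝ :=
  1 / 6 * ((12 * √(12 * lam + 81) + 8 * lam + 108) / lam) ^ (1 / 3 : ℝ)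
    + 2 / 3 * (lam / (12 * √(12 * lam + 81) + 8 * lam + 108)) ^ (1 / 3 : ℝ) + 1 / 3

/-- `z₁ = ((λa² - √(λ²a⁴ - 4λa)) / (2λa))³`. -/
def zOne (lam : ℝ) : ℝ :=
  ((lam * cardanoRoot lam ^ 2 - √(lam ^ 2 * cardanoRoot lam ^ 4 - 4 * lam * cardanoRoot lam))
    / (2 * lam * cardanoRoot lam)) ^ 3

/-- `z₂ = ((λa² + √(λ²a⁴ - 4λa)) / (2λa))³`. -/
def zTwo (lam : ℝ) : ℝ :=
  ((lam * cardanoRoot lam ^ 2 + √(lam ^ 2 * cardanoRoot lam ^ 4 - 4 * lam * cardanoRoot lam))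
    / (2 * lam * cardanoRoot lam)) ^ 3

end HardCore

end

noncomputable section

namespace HardCore

open MeasureTheory Filter Topology
open scoped NNReal ENNReal Classical

/-! ### The tree structure -/

/-! A configuration is recorded by the finite independent set of occupied vertices in each `V_n`,
and every law in play is expressed through `weight lam n z`, that is, through a field `z` on the
sphere `W_n`. Once its parent is empty, each vertex of `W_{n+1}` may be occupied independently of
the others, so summing out `W_{n+1}` replaces `z` by `step lam z` up to a constant
(`sum_weight_union`).

Hence positive collections carrying a measure are exactly the positive solutions of `z = step lam z`
off the root. Necessity holds because a measure determines its field off the root and also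
corresponds to `step lam z` (`CorrespondsTo.eq_step`). For sufficiency, independent coins with odds
`λ z_x : 1` generate a configuration from the root outwards, and the equation makes its cylinder
probabilities proportional to `weight` (`exists_correspondsTo`). The Gibbs kernel is itself a
`weight` whose field takes the values `0` and `1`, and such measures are Gibbs
(`CorrespondsTo.isGibbs`).

For a `G_3^{(2)}`-periodic collection with values `u`, `v` the equation becomes `u = f(v)`, `v =
f(u)` with `f(t) = (1 + λt)⁻³`. If `u ≠ v`, the cube roots have sum `a` and product `1/(λa)`, where
`a` is the positive root of the cubic. So the asymmetric solution is unique up to exchange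
(`eq_zOne_and_eq_zTwo`), and it exists because `λ > 27/16` forces `λa² > 3`.

Extremality is a monotonicity argument. Every boundary condition is a field in `[0, 1]`; each
summation maps bounds `(l, r)` to `(f(r), f(l))`, and the lower bounds starting from `(0, 1)`
converge to `z₁` (`tendsto_boundMap`). So under any Gibbs measure the cylinder probabilities on
`V_m`, relative to that of the empty set, are at least those given by the constant field `z₁` on
`W_m`. The measures `μ⁽¹⁾` and `μ⁽²⁾` attain this bound on every other sphere, so the components of
any convex decomposition must attain it as well. The inequality `g(λ) < 0` plays no part in this; it
is a separate computation from `λa² > 3`. -/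

/-- The first letter of the reduced word of `y`. -/
def firstLetter (k : ℕ) (y : Vertex k) : Option (Fin (k + 1)) :=
  (Monoid.CoprodI.Word.equiv y).fstIdx

theorem eq_ofAdd_one {m : Multiplicative (ZMod 2)} (h : m ≠ 1) :
    m = Multiplicative.ofAdd (1 : ZMod 2) := by
  revert h; revert m; decide

theorem equiv_mul (k : ℕ) (x y : Vertex k) :
    Monoid.CoprodI.Word.equiv (x * y) = x • Monoid.CoprodI.Word.equiv y :=
  mul_smul x y
    (Monoid.CoprodI.Word.empty : Monoid.CoprodI.Word fun _ : Fin (k + 1) => Multiplicative (ZMod 2))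

theorem toList_equiv_gen_mul_of_ne {k : ℕ} {y : Vertex k} {i : Fin (k + 1)}
    (h : firstLetter k y ≠ some i) :
    (Monoid.CoprodI.Word.equiv (gen k i * y)).toList =
      ⟨i, Multiplicative.ofAdd (1 : ZMod 2)⟩ :: (Monoid.CoprodI.Word.equiv y).toList := by
  have h' : (Monoid.CoprodI.Word.equiv y).fstIdx ≠ some i := h
  have h1 : (Multiplicative.ofAdd (1 : ZMod 2)) ≠ 1 := by decide
  have := Monoid.CoprodI.Word.cons_eq_smul (h1 := h') (h2 := h1)
  rw [equiv_mul, gen, ← this]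
  rfl

theorem wordLength_gen_mul_of_ne {k : ℕ} {y : Vertex k} {i : Fin (k + 1)}
    (h : firstLetter k y ≠ some i) : wordLength k (gen k i * y) = wordLength k y + 1 := by
  rw [wordLength, toList_equiv_gen_mul_of_ne h]
  rfl

theorem firstLetter_gen_mul_of_ne {k : ℕ} {y : Vertex k} {i : Fin (k + 1)}
    (h : firstLetter k y ≠ some i) : firstLetter k (gen k i * y) = some i := by
  rw [firstLetter, Monoid.CoprodI.Word.fstIdx, toList_equiv_gen_mul_of_ne h]
  rfl

/-- Generators are involutions, so multiplying by the leading letter cancels it and exposes the tail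
of a reduced word, which cannot start with the same letter. -/
theorem firstLetter_gen_mul_of_eq {k : ℕ} {y : Vertex k} {i : Fin (k + 1)}
    (h : firstLetter k y = some i) : firstLetter k (gen k i * y) ≠ some i := by
  have key : ∀ w : Monoid.CoprodI.Word (fun _ : Fin (k + 1) => Multiplicative (ZMod 2)),
      w.fstIdx = some i → firstLetter k (gen k i * w.prod) ≠ some i := by
    intro w
    induction w using Monoid.CoprodI.Word.consRecOn with
    | empty => intro h; simp [Monoid.CoprodI.Word.fstIdx, Monoid.CoprodI.Word.empty] at h
    | cons j m w h1 h2 ih =>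
      intro h
      rw [Monoid.CoprodI.Word.fstIdx_cons] at h
      obtain rfl : j = i := by simpa using h
      rw [Monoid.CoprodI.Word.prod_cons, eq_ofAdd_one h2, ← mul_assoc]
      have : gen k j * Monoid.CoprodI.of (i := j) (Multiplicative.ofAdd (1 : ZMod 2)) = 1 :=
        gen_mul_self k j
      rw [this, one_mul, firstLetter]
      rwa [show Monoid.CoprodI.Word.equiv w.prod = w from
        Monoid.CoprodI.Word.equiv.apply_symm_apply w]
  have := key _ h
  rwa [show (Monoid.CoprodI.Word.equiv y).prod = y from
    Monoid.CoprodI.Word.equiv.symm_apply_apply y] at this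

theorem wordLength_gen_mul_of_eq {k : ℕ} {y : Vertex k} {i : Fin (k + 1)}
    (h : firstLetter k y = some i) : wordLength k y = wordLength k (gen k i * y) + 1 := by
  rw [← wordLength_gen_mul_of_ne (firstLetter_gen_mul_of_eq h), ← mul_assoc, gen_mul_self, one_mul]

theorem firstLetter_eq_none_iff {k : ℕ} {y : Vertex k} : firstLetter k y = none ↔ y = 1 := by
  rw [firstLetter, Monoid.CoprodI.Word.fstIdx, Option.map_eq_none_iff, List.head?_eq_none_iff]
  constructor
  · intro h
    rw [← Monoid.CoprodI.Word.equiv.symm_apply_apply y]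
    change (Monoid.CoprodI.Word.equiv y).prod = 1
    rw [Monoid.CoprodI.Word.prod, h]
    rfl
  · rintro rfl
    change ((1 : Vertex k) • (Monoid.CoprodI.Word.empty : Monoid.CoprodI.Word _)).toList = []
    rw [one_smul]
    rfl

theorem wordLength_one (k : ℕ) : wordLength k 1 = 0 := by
  have h := (firstLetter_eq_none_iff (k := k)).mpr rfl
  rw [firstLetter, Monoid.CoprodI.Word.fstIdx, Option.map_eq_none_iff,
    List.head?_eq_none_iff] at h
  rw [wordLength, h]
  rfl

theorem gen_inv (k : ℕ) (i : Fin (k + 1)) : (gen k i)⁻¹ = gen k i :=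
  inv_eq_of_mul_eq_one_left (gen_mul_self k i)

theorem gen_injective (k : ℕ) : Function.Injective (gen k) := by
  intro i j h
  have h1 : ∀ i, firstLetter k (gen k i) = some i := by
    intro i
    have h0 : firstLetter k 1 ≠ some i := by
      rw [firstLetter_eq_none_iff.mpr rfl]
      simp
    simpa using firstLetter_gen_mul_of_ne h0
  have := h1 i
  rw [h, h1 j] at this
  simpa using this.symm

/-- The distance from the root. -/
def depth (k : ℕ) (x : Vertex k) : ℕ := (tree k).dist 1 x

theorem wordLength_inv_mul_gen_le {k : ℕ} (x : Vertex k) (i : Fin (k + 1)) :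
    wordLength k (x * gen k i)⁻¹ ≤ wordLength k x⁻¹ + 1 := by
  rw [mul_inv_rev, gen_inv]
  by_cases h : firstLetter k x⁻¹ = some i
  · have := wordLength_gen_mul_of_eq h
    omega
  · exact (wordLength_gen_mul_of_ne h).le

/-- Edges multiply on the right, while reduced words are built on the left; inversion turns `x *
a_i` into `a_i * x⁻¹`. Stripping leading letters gives a path to the root, and along an edge the
word length grows by at most one. -/
theorem depth_eq_wordLength_inv (k : ℕ) (x : Vertex k) : depth k x = wordLength k x⁻¹ := by
  apply le_antisymm
  · have key : ∀ n, ∀ x : Vertex k, wordLength k x⁻¹ = n → (tree k).dist 1 x ≤ n := by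
      intro n
      induction n with
      | zero =>
        intro x hx
        rcases h : firstLetter k x⁻¹ with _ | i
        · rw [firstLetter_eq_none_iff, inv_eq_one] at h
          rw [h, SimpleGraph.dist_self]
        · have := wordLength_gen_mul_of_eq h
          omega
      | succ n ih =>
        intro x hx
        rcases h : firstLetter k x⁻¹ with _ | i
        · rw [firstLetter_eq_none_iff] at h
          rw [h, wordLength_one] at hx
          omega
        · have h1 := wordLength_gen_mul_of_eq h
          have h2 : (x * gen k i)⁻¹ = gen k i * x⁻¹ := by rw [mul_inv_rev, gen_inv]
          have h3 := ih (x * gen k i) (by rw [h2]; omega)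
          have h4 : (tree k).Adj (x * gen k i) x :=
            (tree_adj k _ _).mpr ⟨i, by rw [mul_assoc, gen_mul_self, mul_one]⟩
          have h5 := (tree_connected k).dist_triangle (u := 1) (v := x * gen k i) (w := x)
          rw [SimpleGraph.dist_eq_one_iff_adj.mpr h4] at h5
          omega
    exact key _ x rfl
  · have key : ∀ (u v : Vertex k) (p : (tree k).Walk u v),
        wordLength k v⁻¹ ≤ wordLength k u⁻¹ + p.length := by
      intro u v p
      induction p with
      | nil => simp
      | @cons u v w h q ih =>
        obtain ⟨i, rfl⟩ := (tree_adj k _ _).mp h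
        have := wordLength_inv_mul_gen_le u i
        rw [SimpleGraph.Walk.length_cons]
        omega
    obtain ⟨p, hp⟩ := (tree_connected k).exists_walk_length_eq_dist 1 x
    have := key _ _ p
    rw [inv_one, wordLength_one, hp] at this
    simpa [depth] using this

/-- The last letter of the reduced word of `x⁻¹`, that is, the direction towards the root. -/
def upward (k : ℕ) (x : Vertex k) : Option (Fin (k + 1)) := firstLetter k x⁻¹

theorem upward_eq_none_iff {k : ℕ} {x : Vertex k} : upward k x = none ↔ x = 1 := by
  rw [upward, firstLetter_eq_none_iff, inv_eq_one]

theorem depth_one (k : ℕ) : depth k 1 = 0 := by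
  rw [depth_eq_wordLength_inv, inv_one, wordLength_one]

theorem depth_mul_gen_of_ne {k : ℕ} {x : Vertex k} {i : Fin (k + 1)} (h : upward k x ≠ some i) :
    depth k (x * gen k i) = depth k x + 1 := by
  rw [depth_eq_wordLength_inv, depth_eq_wordLength_inv, mul_inv_rev, gen_inv]
  exact wordLength_gen_mul_of_ne h

theorem depth_mul_gen_of_eq {k : ℕ} {x : Vertex k} {i : Fin (k + 1)} (h : upward k x = some i) :
    depth k x = depth k (x * gen k i) + 1 := by
  rw [depth_eq_wordLength_inv, depth_eq_wordLength_inv, mul_inv_rev, gen_inv]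
  exact wordLength_gen_mul_of_eq h

theorem upward_mul_gen_of_ne {k : ℕ} {x : Vertex k} {i : Fin (k + 1)} (h : upward k x ≠ some i) :
    upward k (x * gen k i) = some i := by
  rw [upward, mul_inv_rev, gen_inv]
  exact firstLetter_gen_mul_of_ne h

theorem depth_eq_zero_iff {k : ℕ} {x : Vertex k} : depth k x = 0 ↔ x = 1 := by
  constructor
  · intro h
    by_contra hx
    obtain ⟨i, hi⟩ := Option.ne_none_iff_exists'.mp (mt upward_eq_none_iff.mp hx)
    have := depth_mul_gen_of_eq hi
    omega
  · rintro rfl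
    exact depth_one k

/-- The neighbour of `x` that is closer to the root (the root itself if `x` is the root). -/
def parent (k : ℕ) (x : Vertex k) : Vertex k :=
  match upward k x with
  | none => 1
  | some i => x * gen k i

theorem parent_of_upward_eq {k : ℕ} {x : Vertex k} {i : Fin (k + 1)} (h : upward k x = some i) :
    parent k x = x * gen k i := by
  rw [parent, h]

theorem depth_parent {k : ℕ} {x : Vertex k} (hx : x ≠ 1) :
    depth k x = depth k (parent k x) + 1 := by
  obtain ⟨i, hi⟩ := Option.ne_none_iff_exists'.mp (mt upward_eq_none_iff.mp hx)
  rw [parent_of_upward_eq hi]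
  exact depth_mul_gen_of_eq hi

theorem parent_mul_gen_of_ne {k : ℕ} {x : Vertex k} {i : Fin (k + 1)} (h : upward k x ≠ some i) :
    parent k (x * gen k i) = x := by
  rw [parent_of_upward_eq (upward_mul_gen_of_ne h), mul_assoc, gen_mul_self, mul_one]

theorem mul_gen_ne_one_of_ne {k : ℕ} {x : Vertex k} {i : Fin (k + 1)} (h : upward k x ≠ some i) :
    x * gen k i ≠ 1 := by
  intro h1
  have := depth_mul_gen_of_ne h
  rw [h1, depth_one] at this
  omega

/-- Two vertices are neighbours iff one of them is the parent of the other. -/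
theorem adj_iff_parent {k : ℕ} {x y : Vertex k} :
    (tree k).Adj x y ↔ (x ≠ 1 ∧ parent k x = y) ∨ (y ≠ 1 ∧ parent k y = x) := by
  have aux : ∀ {x y : Vertex k}, x ≠ 1 → parent k x = y → (tree k).Adj x y := by
    intro x y hx hp
    obtain ⟨i, hi⟩ := Option.ne_none_iff_exists'.mp (mt upward_eq_none_iff.mp hx)
    exact (tree_adj k _ _).mpr ⟨i, by rw [← hp, parent_of_upward_eq hi]⟩
  constructor
  · intro h
    obtain ⟨i, rfl⟩ := (tree_adj k _ _).mp h
    by_cases hi : upward k x = some i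
    · refine Or.inl ⟨?_, parent_of_upward_eq hi⟩
      rintro rfl
      rw [upward_eq_none_iff.mpr rfl] at hi
      cases hi
    · exact Or.inr ⟨mul_gen_ne_one_of_ne hi, parent_mul_gen_of_ne hi⟩
  · rintro (⟨h1, h2⟩ | ⟨h1, h2⟩)
    · exact aux h1 h2
    · exact (aux h1 h2).symm

/-- The neighbours of `x` that are further away from the root. -/
def children (k : ℕ) (x : Vertex k) : Finset (Vertex k) :=
  (Finset.univ.filter fun i => upward k x ≠ some i).image fun i => x * gen k i

theorem mem_children {k : ℕ} {x y : Vertex k} : y ∈ children k x ↔ y ≠ 1 ∧ parent k y = x := by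
  simp only [children, Finset.mem_image, Finset.mem_filter, Finset.mem_univ, true_and]
  constructor
  · rintro ⟨i, hi, rfl⟩
    exact ⟨mul_gen_ne_one_of_ne hi, parent_mul_gen_of_ne hi⟩
  · rintro ⟨hy, rfl⟩
    obtain ⟨i, hi⟩ := Option.ne_none_iff_exists'.mp (mt upward_eq_none_iff.mp hy)
    rw [parent_of_upward_eq hi]
    refine ⟨i, ?_, by rw [mul_assoc, gen_mul_self, mul_one]⟩
    intro h
    have h1 := depth_mul_gen_of_eq hi
    have h2 := depth_mul_gen_of_eq h
    rw [mul_assoc, gen_mul_self, mul_one] at h2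
    omega

theorem depth_of_mem_children {k : ℕ} {x y : Vertex k} (h : y ∈ children k x) :
    depth k y = depth k x + 1 := by
  obtain ⟨h1, rfl⟩ := mem_children.mp h
  exact depth_parent h1

/-- Exactly one of the `k + 1` neighbours leads towards the root. The root has `k + 1` children, so
it is excluded from all bounds that use the `k`-th power. -/
theorem card_children {k : ℕ} {x : Vertex k} (hx : x ≠ 1) : (children k x).card = k := by
  rw [children, Finset.card_image_of_injective _ fun i j h => gen_injective k (mul_left_cancel h)]
  obtain ⟨i, hi⟩ := Option.ne_none_iff_exists'.mp (mt upward_eq_none_iff.mp hx)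
  have : (Finset.univ.filter fun j => upward k x ≠ some j) = Finset.univ.erase i := by
    ext j
    simp [hi, eq_comm]
  rw [this, Finset.card_erase_of_mem (Finset.mem_univ _), Finset.card_univ, Fintype.card_fin]
  rfl

theorem mem_evenSubgroup_iff_even_depth {k : ℕ} {x : Vertex k} :
    x ∈ evenSubgroup k ↔ Even (depth k x) := by
  rw [depth_eq_wordLength_inv, ← mem_evenSubgroup, inv_mem_iff]

/-! ### Independent sets and their weights -/

/-- `V_n` as a finite set. -/
def ballFinset (k n : ℕ) : Finset (Vertex k) := (ball_finite k n).toFinset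

theorem mem_ballFinset {k n : ℕ} {x : Vertex k} : x ∈ ballFinset k n ↔ depth k x ≤ n := by
  rw [ballFinset, Set.Finite.mem_toFinset]
  rfl

theorem mem_ball {k n : ℕ} {x : Vertex k} : x ∈ ball k n ↔ depth k x ≤ n := Iff.rfl

/-- `W_n` as a finite set. -/
def sphereFinset (k n : ℕ) : Finset (Vertex k) := (ballFinset k n).filter fun x => depth k x = n

theorem mem_sphereFinset {k n : ℕ} {x : Vertex k} : x ∈ sphereFinset k n ↔ depth k x = n := by
  rw [sphereFinset, Finset.mem_filter, mem_ballFinset]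
  omega

/-- A set of vertices is independent if it contains no two neighbours. -/
def IsIndep {k : ℕ} (S : Finset (Vertex k)) : Prop := ∀ x ∈ S, x ≠ 1 → parent k x ∉ S

/-- The independent subsets of `V_n`. -/
def indepSets (k n : ℕ) : Finset (Finset (Vertex k)) := (ballFinset k n).powerset.filter IsIndep

theorem mem_indepSets {k n : ℕ} {S : Finset (Vertex k)} :
    S ∈ indepSets k n ↔ (∀ x ∈ S, depth k x ≤ n) ∧ IsIndep S := by
  rw [indepSets, Finset.mem_filter, Finset.mem_powerset, Finset.subset_iff]
  simp only [mem_ballFinset]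

theorem empty_mem_indepSets (k n : ℕ) : ∅ ∈ indepSets k n := by
  rw [mem_indepSets]
  simp [IsIndep]

/-- The part of `S` in `V_n`. -/
def truncate {k : ℕ} (n : ℕ) (S : Finset (Vertex k)) : Finset (Vertex k) :=
  S.filter fun x => depth k x ≤ n

theorem truncate_mem_indepSets {k n : ℕ} {S : Finset (Vertex k)} (hS : IsIndep S) :
    truncate n S ∈ indepSets k n := by
  rw [mem_indepSets]
  refine ⟨fun x hx => (Finset.mem_filter.mp hx).2, fun x hx h1 h2 => ?_⟩
  exact hS x (Finset.mem_filter.mp hx).1 h1 (Finset.mem_filter.mp h2).1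

/-- The vertices of `W_{n+1}` whose parent is not in `S`. -/
def freeSphere {k : ℕ} (n : ℕ) (S : Finset (Vertex k)) : Finset (Vertex k) :=
  (sphereFinset k (n + 1)).filter fun y => parent k y ∉ S

theorem ne_one_of_depth_eq_succ {k n : ℕ} {x : Vertex k} (h : depth k x = n + 1) : x ≠ 1 := by
  rintro rfl
  rw [depth_one] at h
  omega

theorem truncate_union {k n m : ℕ} {S T : Finset (Vertex k)} (hm : m ≤ n)
    (hT : T ⊆ sphereFinset k (n + 1)) : truncate m (S ∪ T) = truncate m S := by
  ext x
  simp only [truncate, Finset.mem_filter, Finset.mem_union]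
  constructor
  · rintro ⟨h | h, h2⟩
    · exact ⟨h, h2⟩
    · have := mem_sphereFinset.mp (hT h)
      omega
  · rintro ⟨h, h2⟩
    exact ⟨Or.inl h, h2⟩

theorem truncate_self {k n : ℕ} {S : Finset (Vertex k)} (hS : S ∈ indepSets k n) :
    truncate n S = S :=
  Finset.filter_true_of_mem (mem_indepSets.mp hS).1

theorem freeSphere_subset {k n : ℕ} (S : Finset (Vertex k)) :
    freeSphere n S ⊆ sphereFinset k (n + 1) := Finset.filter_subset _ _

theorem filter_depth_union {k n : ℕ} {S T : Finset (Vertex k)} (hS : S ∈ indepSets k n)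
    (hT : T ⊆ sphereFinset k (n + 1)) :
    ((S ∪ T).filter fun x => depth k x = n + 1) = T := by
  ext x
  simp only [Finset.mem_filter, Finset.mem_union]
  constructor
  · rintro ⟨h | h, h2⟩
    · have := (mem_indepSets.mp hS).1 x h
      omega
    · exact h
  · intro h
    exact ⟨Or.inr h, mem_sphereFinset.mp (hT h)⟩

theorem union_mem_indepSets {k n : ℕ} {S T : Finset (Vertex k)} (hS : S ∈ indepSets k n)
    (hT : T ⊆ freeSphere n S) : S ∪ T ∈ indepSets k (n + 1) := by
  rw [mem_indepSets] at hS ⊢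
  have hTd : ∀ x ∈ T, depth k x = n + 1 := fun x hx =>
    mem_sphereFinset.mp (freeSphere_subset S (hT hx))
  constructor
  · intro x hx
    rcases Finset.mem_union.mp hx with h | h
    · have := hS.1 x h
      omega
    · exact (hTd x h).le
  · intro x hx h1 h2
    have hd := depth_parent h1
    rcases Finset.mem_union.mp hx with h | h
    · rcases Finset.mem_union.mp h2 with h' | h'
      · exact hS.2 x h h1 h'
      · have := hTd _ h'
        have := hS.1 x h
        omega
    · rcases Finset.mem_union.mp h2 with h' | h'
      · exact (Finset.mem_filter.mp (hT h)).2 h'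
      · have := hTd _ h'
        have := hTd _ h
        omega

/-- An independent subset of `V_{n+1}` is an independent subset of `V_n` together with a set of
vertices of `W_{n+1}` with parents outside it. -/
theorem sum_indepSets_succ {M : Type*} [AddCommMonoid M] (k n : ℕ)
    (G : Finset (Vertex k) → M) :
    ∑ R ∈ indepSets k (n + 1), G R =
      ∑ S ∈ indepSets k n, ∑ T ∈ (freeSphere n S).powerset, G (S ∪ T) := by
  rw [Finset.sum_sigma']
  refine Finset.sum_bij' (fun R _ => ⟨truncate n R, R.filter fun x => depth k x = n + 1⟩)
    (fun p _ => p.1 ∪ p.2) ?_ ?_ ?_ ?_ ?_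
  · intro R hR
    rw [mem_indepSets] at hR
    rw [Finset.mem_sigma]
    refine ⟨truncate_mem_indepSets hR.2, ?_⟩
    rw [Finset.mem_powerset]
    intro x hx
    rw [Finset.mem_filter] at hx
    rw [freeSphere, Finset.mem_filter, mem_sphereFinset]
    refine ⟨hx.2, fun h => ?_⟩
    exact hR.2 x hx.1 (ne_one_of_depth_eq_succ hx.2) (Finset.mem_filter.mp h).1
  · rintro ⟨S, T⟩ h
    rw [Finset.mem_sigma, Finset.mem_powerset] at h
    exact union_mem_indepSets h.1 h.2
  · intro R hR
    rw [mem_indepSets] at hR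
    ext x
    simp only [truncate, Finset.mem_union, Finset.mem_filter]
    constructor
    · rintro (h | h) <;> exact h.1
    · intro h
      have := hR.1 x h
      by_cases h2 : depth k x ≤ n
      · exact Or.inl ⟨h, h2⟩
      · exact Or.inr ⟨h, by omega⟩
  · rintro ⟨S, T⟩ h
    rw [Finset.mem_sigma, Finset.mem_powerset] at h
    have h2 := h.2.trans (freeSphere_subset S)
    simp only
    rw [truncate_union le_rfl h2, truncate_self h.1, filter_depth_union h.1 h2]
  · intro R hR
    rw [mem_indepSets] at hR
    congr 1
    ext x
    simp only [truncate, Finset.mem_union, Finset.mem_filter]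
    constructor
    · intro h
      have := hR.1 x h
      by_cases h2 : depth k x ≤ n
      · exact Or.inl ⟨h, h2⟩
      · exact Or.inr ⟨h, by omega⟩
    · rintro (h | h) <;> exact h.1

/-- The weight `λ^{|S|} ∏_{x ∈ S ∩ W_n} z_x`. -/
def weight {k : ℕ} (lam : ℝ) (n : ℕ) (z : Vertex k → ℝ) (S : Finset (Vertex k)) : ℝ :=
  lam ^ S.card * ∏ x ∈ S.filter (fun x => depth k x = n), z x

/-- The recursion for the boundary fields. -/
def step {k : ℕ} (lam : ℝ) (z : Vertex k → ℝ) (x : Vertex k) : ℝ :=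
  ∏ y ∈ children k x, (1 + lam * z y)⁻¹

theorem weight_congr {k n : ℕ} (lam : ℝ) {z z' : Vertex k → ℝ} (S : Finset (Vertex k))
    (h : ∀ x, depth k x = n → z x = z' x) : weight lam n z S = weight lam n z' S := by
  rw [weight, weight]
  congr 1
  exact Finset.prod_congr rfl fun x hx => h x (Finset.mem_filter.mp hx).2

theorem weight_empty {k : ℕ} (lam : ℝ) (n : ℕ) (z : Vertex k → ℝ) : weight lam n z ∅ = 1 := by
  simp [weight]

theorem weight_nonneg {k n : ℕ} {lam : ℝ} (hlam : 0 ≤ lam) {z : Vertex k → ℝ}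
    (hz : ∀ x, depth k x = n → 0 ≤ z x) (S : Finset (Vertex k)) : 0 ≤ weight lam n z S :=
  mul_nonneg (pow_nonneg hlam _)
    (Finset.prod_nonneg fun x hx => hz x (Finset.mem_filter.mp hx).2)

theorem weight_pos {k n : ℕ} {lam : ℝ} (hlam : 0 < lam) {z : Vertex k → ℝ}
    (hz : ∀ x, depth k x = n → 0 < z x) (S : Finset (Vertex k)) : 0 < weight lam n z S :=
  mul_pos (pow_pos hlam _)
    (Finset.prod_pos fun x hx => hz x (Finset.mem_filter.mp hx).2)

theorem weight_mono {k n : ℕ} {lam : ℝ} (hlam : 0 ≤ lam) {z z' : Vertex k → ℝ}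
    (hz : ∀ x, depth k x = n → 0 ≤ z x) (h : ∀ x, depth k x = n → z x ≤ z' x)
    (S : Finset (Vertex k)) : weight lam n z S ≤ weight lam n z' S :=
  mul_le_mul_of_nonneg_left
    (Finset.prod_le_prod (fun x hx => hz x (Finset.mem_filter.mp hx).2)
      fun x hx => h x (Finset.mem_filter.mp hx).2) (pow_nonneg hlam _)

theorem sum_weight_pos {k n : ℕ} {lam : ℝ} (hlam : 0 ≤ lam) {z : Vertex k → ℝ}
    (hz : ∀ x, depth k x = n → 0 ≤ z x) : 0 < ∑ S ∈ indepSets k n, weight lam n z S := by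
  refine Finset.sum_pos' (fun S _ => weight_nonneg hlam hz S) ⟨∅, empty_mem_indepSets k n, ?_⟩
  rw [weight_empty]
  exact one_pos

theorem weight_union {k n : ℕ} (lam : ℝ) (z : Vertex k → ℝ) {S T : Finset (Vertex k)}
    (hS : S ∈ indepSets k n) (hT : T ⊆ sphereFinset k (n + 1)) :
    weight lam (n + 1) z (S ∪ T) = lam ^ S.card * ∏ y ∈ T, (lam * z y) := by
  have hd : Disjoint S T := by
    rw [Finset.disjoint_left]
    intro x hx hx'
    have h1 := (mem_indepSets.mp hS).1 x hx
    have h2 := mem_sphereFinset.mp (hT hx')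
    omega
  rw [weight, filter_depth_union hS hT, Finset.card_union_of_disjoint hd, pow_add,
    Finset.prod_mul_distrib, Finset.prod_const, mul_assoc]

/-- The product of a function over the vertices of `W_{n+1}` whose parents are in `S`. -/
theorem prod_sphereFinset_parent_mem {k n : ℕ} (S : Finset (Vertex k)) (f : Vertex k → ℝ) :
    ∏ y ∈ (sphereFinset k (n + 1)).filter (fun y => parent k y ∈ S), f y =
      ∏ x ∈ S.filter (fun x => depth k x = n), ∏ y ∈ children k x, f y := by
  rw [← Finset.prod_fiberwise_of_maps_to (g := parent k)
    (t := S.filter (fun x => depth k x = n))]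
  · refine Finset.prod_congr rfl fun x hx => Finset.prod_congr ?_ fun _ _ => rfl
    rw [Finset.mem_filter] at hx
    ext y
    rw [Finset.mem_filter, Finset.mem_filter, mem_sphereFinset, mem_children]
    constructor
    · rintro ⟨⟨h1, _⟩, h2⟩
      exact ⟨ne_one_of_depth_eq_succ h1, h2⟩
    · rintro ⟨h1, rfl⟩
      exact ⟨⟨by rw [depth_parent h1, hx.2], hx.1⟩, rfl⟩
  · intro y hy
    rw [Finset.mem_filter, mem_sphereFinset] at hy
    have := depth_parent (ne_one_of_depth_eq_succ hy.1)
    rw [Finset.mem_filter]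
    exact ⟨hy.2, by omega⟩

/-- Each vertex of `W_{n+1}` with empty parent contributes a factor `1 + λ z_y`. This product is the
one over the whole sphere divided by the one over vertices with parent in `S`; grouping the latter
by parent produces `step`. -/
theorem sum_weight_union {k n : ℕ} {lam : ℝ} {z : Vertex k → ℝ}
    (hz : ∀ x, depth k x = n + 1 → 1 + lam * z x ≠ 0) {S : Finset (Vertex k)}
    (hS : S ∈ indepSets k n) :
    ∑ T ∈ (freeSphere n S).powerset, weight lam (n + 1) z (S ∪ T) =
      (∏ y ∈ sphereFinset k (n + 1), (1 + lam * z y)) * weight lam n (step lam z) S := by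
  have h1 : ∑ T ∈ (freeSphere n S).powerset, weight lam (n + 1) z (S ∪ T) =
      lam ^ S.card * ∏ y ∈ freeSphere n S, (1 + lam * z y) := by
    rw [Finset.prod_one_add, Finset.mul_sum]
    refine Finset.sum_congr rfl fun T hT => weight_union lam z hS ?_
    exact (Finset.mem_powerset.mp hT).trans (freeSphere_subset S)
  have h2 : ∏ y ∈ sphereFinset k (n + 1), (1 + lam * z y) =
      (∏ y ∈ (sphereFinset k (n + 1)).filter (fun y => parent k y ∈ S), (1 + lam * z y)) *
        ∏ y ∈ freeSphere n S, (1 + lam * z y) :=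
    (Finset.prod_filter_mul_prod_filter_not _ _ _).symm
  have h3 : weight lam n (step lam z) S = lam ^ S.card *
      (∏ y ∈ (sphereFinset k (n + 1)).filter (fun y => parent k y ∈ S), (1 + lam * z y))⁻¹ := by
    rw [weight, ← Finset.prod_inv_distrib, prod_sphereFinset_parent_mem]
    rfl
  have h4 : ∏ y ∈ (sphereFinset k (n + 1)).filter (fun y => parent k y ∈ S), (1 + lam * z y)
      ≠ 0 :=
    Finset.prod_ne_zero_iff.mpr fun y hy =>
      hz y (mem_sphereFinset.mp (Finset.mem_filter.mp hy).1)
  rw [h1, h2, h3]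
  field_simp

/-! ### Configurations as independent sets -/

/-- The occupied vertices of `ω` in `V_n`. -/
def occupied {k : ℕ} (n : ℕ) (ω : Config k) : Finset (Vertex k) :=
  (ballFinset k n).filter fun x => ω.1 x = 1

/-- The event that the set of occupied vertices in `V_n` is `S`. -/
def cyl {k : ℕ} (n : ℕ) (S : Finset (Vertex k)) : Set (Config k) := {ω | occupied n ω = S}

theorem mem_occupied {k n : ℕ} {ω : Config k} {x : Vertex k} :
    x ∈ occupied n ω ↔ depth k x ≤ n ∧ ω.1 x = 1 := by
  rw [occupied, Finset.mem_filter, mem_ballFinset]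

theorem fin_two_mul_eq_zero_iff (a b : Fin 2) : a * b = 0 ↔ ¬ (a = 1 ∧ b = 1) := by
  revert a b; decide

theorem fin_two_eq_iff (a b : Fin 2) : a = b ↔ (a = 1 ↔ b = 1) := by
  revert a b; decide

theorem occupied_mem_indepSets {k : ℕ} (n : ℕ) (ω : Config k) : occupied n ω ∈ indepSets k n := by
  rw [mem_indepSets]
  refine ⟨fun x hx => (mem_occupied.mp hx).1, fun x hx h1 h2 => ?_⟩
  have := ω.2 x (parent k x) (adj_iff_parent.mpr (Or.inl ⟨h1, rfl⟩))
  rw [fin_two_mul_eq_zero_iff] at this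
  exact this ⟨(mem_occupied.mp hx).2, (mem_occupied.mp h2).2⟩

theorem truncate_occupied {k m n : ℕ} (h : m ≤ n) (ω : Config k) :
    truncate m (occupied n ω) = occupied m ω := by
  ext x
  rw [truncate, Finset.mem_filter, mem_occupied, mem_occupied]
  constructor
  · rintro ⟨⟨_, h1⟩, h2⟩
    exact ⟨h2, h1⟩
  · rintro ⟨h1, h2⟩
    exact ⟨⟨h1.trans h, h2⟩, h1⟩

/-- The occupied vertices of a configuration on `V_n`. -/
def support {k n : ℕ} (σ : LocalConfig k n) : Finset (Vertex k) :=
  (Finset.univ.filter fun x : ball k n => σ.1 x = 1).map (Function.Embedding.subtype _)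

theorem mem_support {k n : ℕ} {σ : LocalConfig k n} {x : Vertex k} :
    x ∈ support σ ↔ ∃ h : x ∈ ball k n, σ.1 ⟨x, h⟩ = 1 := by
  simp [support]

theorem coe_mem_support {k n : ℕ} {σ : LocalConfig k n} {x : ball k n} :
    (x : Vertex k) ∈ support σ ↔ σ.1 x = 1 := by
  rw [mem_support]
  exact ⟨fun ⟨_, h⟩ => h, fun h => ⟨x.2, h⟩⟩

theorem support_mem_indepSets {k n : ℕ} (σ : LocalConfig k n) : support σ ∈ indepSets k n := by
  rw [mem_indepSets]
  refine ⟨fun x hx => (mem_support.mp hx).1, fun x hx h1 h2 => ?_⟩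
  obtain ⟨hx1, hx2⟩ := mem_support.mp hx
  obtain ⟨hp1, hp2⟩ := mem_support.mp h2
  have := σ.2 ⟨x, hx1⟩ ⟨parent k x, hp1⟩ (adj_iff_parent.mpr (Or.inl ⟨h1, rfl⟩))
  rw [fin_two_mul_eq_zero_iff] at this
  exact this ⟨hx2, hp2⟩

theorem support_injective (k n : ℕ) : Function.Injective (support (k := k) (n := n)) := by
  intro σ τ h
  refine Subtype.ext (funext fun x => ?_)
  rw [fin_two_eq_iff, ← coe_mem_support, ← coe_mem_support, h]

theorem exists_support_eq {k n : ℕ} {S : Finset (Vertex k)} (hS : S ∈ indepSets k n) :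
    ∃ σ : LocalConfig k n, support σ = S := by
  rw [mem_indepSets] at hS
  refine ⟨⟨fun x => if (x : Vertex k) ∈ S then 1 else 0, ?_⟩, ?_⟩
  · intro x y hxy
    rw [fin_two_mul_eq_zero_iff]
    rintro ⟨hx, hy⟩
    have hx' : (x : Vertex k) ∈ S := by
      by_contra h
      simp [h] at hx
    have hy' : (y : Vertex k) ∈ S := by
      by_contra h
      simp [h] at hy
    rcases adj_iff_parent.mp hxy with ⟨h1, h2⟩ | ⟨h1, h2⟩
    · exact hS.2 _ hx' h1 (h2 ▸ hy')
    · exact hS.2 _ hy' h1 (h2 ▸ hx')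
  · ext x
    rw [mem_support]
    constructor
    · rintro ⟨h, h1⟩
      by_contra h2
      simp [h2] at h1
    · intro h
      exact ⟨hS.1 x h, by simp [h]⟩

theorem sum_localConfig {M : Type*} [AddCommMonoid M] (k n : ℕ) (G : Finset (Vertex k) → M) :
    ∑ τ : LocalConfig k n, G (support τ) = ∑ S ∈ indepSets k n, G S :=
  Finset.sum_bij (fun τ _ => support τ) (fun τ _ => support_mem_indepSets τ)
    (fun _ _ _ _ h => support_injective k n h)
    (fun _ hS => (exists_support_eq hS).imp fun _ h => ⟨Finset.mem_univ _, h⟩) fun _ _ => rfl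

theorem cylinder_eq_cyl {k n : ℕ} (σ : LocalConfig k n) : cylinder σ = cyl n (support σ) := by
  ext ω
  rw [cyl, Set.mem_ofPred_eq, cylinder, Set.mem_ofPred_eq, Finset.ext_iff]
  constructor
  · intro h x
    rw [mem_occupied, mem_support]
    constructor
    · rintro ⟨h1, h2⟩
      exact ⟨h1, by rw [← h ⟨x, h1⟩, h2]⟩
    · rintro ⟨h1, h2⟩
      exact ⟨h1, by rw [h ⟨x, h1⟩, h2]⟩
  · intro h x
    rw [fin_two_eq_iff, ← coe_mem_support, ← h, mem_occupied]
    exact ⟨fun h => ⟨x.2, h⟩, fun h => h.2⟩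

theorem numOccupied_eq_card {k n : ℕ} (σ : LocalConfig k n) :
    numOccupied σ = (support σ).card := by
  rw [support, Finset.card_map, numOccupied]

theorem finiteWeight_eq_weight {k n : ℕ} (lam : ℝ) (z : Vertex k → ℝ) (σ : LocalConfig k n) :
    finiteWeight lam (fun x => ![1, z x]) σ = weight lam n z (support σ) := by
  rw [finiteWeight, weight, numOccupied_eq_card]
  congr 1
  have h1 : ∀ x : ball k n, (![1, z x] : Fin 2 → ℝ) (σ.1 x) = if σ.1 x = 1 then z x else 1 := by
    intro x
    have h2 : ∀ a : Fin 2, (![1, z x] : Fin 2 → ℝ) a = if a = 1 then z x else 1 := by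
      intro a
      fin_cases a <;> simp
    exact h2 _
  simp_rw [h1]
  rw [← Finset.prod_filter, support, Finset.filter_map, Finset.prod_map, Finset.filter_filter,
    Finset.filter_filter]
  refine Finset.prod_congr ?_ fun _ _ => rfl
  ext x
  rw [Finset.mem_filter, Finset.mem_filter]
  exact ⟨fun h => ⟨Finset.mem_univ _, h.2.2, h.2.1⟩, fun h => ⟨Finset.mem_univ _, h.2.2, h.2.1⟩⟩

theorem finiteProb_eq {k n : ℕ} (lam : ℝ) (z : Vertex k → ℝ) (σ : LocalConfig k n) :
    finiteProb lam (fun x => ![1, z x]) σ =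
      weight lam n z (support σ) / ∑ S ∈ indepSets k n, weight lam n z S := by
  rw [finiteProb, finiteWeight_eq_weight, ← sum_localConfig]
  simp_rw [finiteWeight_eq_weight]

/-- The boundary field of a configuration: `1` at the vertices without occupied children and `0` at
the others. -/
def boundaryField {k : ℕ} (ω : Config k) (x : Vertex k) : ℝ :=
  if ∃ y ∈ children k x, ω.1 y = 1 then 0 else 1

/-- Both `σ_n` and `ω` are admissible, so a conflict can only occur on an edge between `W_n` and
`W_{n+1}`. -/
theorem isAdmissible_join_iff {k n : ℕ} (σ : LocalConfig k n) (ω : Config k) :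
    IsAdmissible (join σ ω) ↔
      ∀ x ∈ (support σ).filter (fun x => depth k x = n), ¬ ∃ y ∈ children k x, ω.1 y = 1 := by
  have key : ∀ x : ball k (n + 1), join σ ω x = 1 ↔
      ((x : Vertex k) ∈ support σ ∨ depth k x = n + 1 ∧ ω.1 x = 1) := by
    intro x
    have hx := mem_ball.mp x.2
    by_cases h : (x : Vertex k) ∈ ball k n
    · rw [join, dif_pos h, mem_support]
      have := mem_ball.mp h
      constructor
      · intro h1
        exact Or.inl ⟨h, h1⟩
      · rintro (⟨_, h1⟩ | ⟨h1, _⟩)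
        · exact h1
        · omega
    · rw [join, dif_neg h, mem_support]
      have h1 := mt mem_ball.mpr h
      constructor
      · intro h1
        exact Or.inr ⟨by omega, h1⟩
      · rintro (⟨h1, _⟩ | ⟨_, h1⟩)
        · exact absurd h1 h
        · exact h1
  constructor
  · rintro h x hx ⟨y, hy, hy1⟩
    rw [Finset.mem_filter] at hx
    have hd := depth_of_mem_children hy
    obtain ⟨h1, h2⟩ := mem_children.mp hy
    have := h ⟨x, mem_ball.mpr (by omega)⟩ ⟨y, mem_ball.mpr (by omega)⟩
      (adj_iff_parent.mpr (Or.inr ⟨h1, h2⟩))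
    rw [fin_two_mul_eq_zero_iff, key, key] at this
    exact this ⟨Or.inl hx.1, Or.inr ⟨by simpa [hx.2] using hd, hy1⟩⟩
  · intro h
    have main : ∀ x y : ball k (n + 1), (y : Vertex k) ≠ 1 → parent k y = x →
        join σ ω x = 1 → join σ ω y = 1 → False := by
      intro x y hy hp hx1 hy1
      rw [key] at hx1 hy1
      have hd := depth_parent hy
      rw [hp] at hd
      have hy2 := mem_ball.mp y.2
      have hσ := mem_indepSets.mp (support_mem_indepSets σ)
      rcases hx1 with hx1 | hx1
      · rcases hy1 with hy1 | hy1
        · exact hσ.2 _ hy1 hy (hp ▸ hx1)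
        · exact h x (Finset.mem_filter.mpr ⟨hx1, by omega⟩)
            ⟨y, mem_children.mpr ⟨hy, hp⟩, hy1.2⟩
      · omega
    intro x y hxy
    rw [fin_two_mul_eq_zero_iff]
    rintro ⟨hx, hy⟩
    rcases adj_iff_parent.mp hxy with ⟨h1, h2⟩ | ⟨h1, h2⟩
    · exact main y x h1 h2 hy hx
    · exact main x y h1 h2 hx hy

/-- A hard boundary condition is a field too: an occupied vertex of `W_n` with an occupied child
gets factor `0`. The Gibbs kernel thus falls under the same recursion as the collections. -/
theorem boundaryWeight_eq_weight {k n : ℕ} (lam : ℝ) (σ : LocalConfig k n) (ω : Config k) :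
    boundaryWeight lam σ ω = weight lam n (boundaryField ω) (support σ) := by
  rw [boundaryWeight, weight, isAdmissible_join_iff, numOccupied_eq_card]
  split_ifs with h
  · rw [Finset.prod_eq_one, mul_one]
    intro x hx
    rw [boundaryField, if_neg (h x hx)]
  · push Not at h
    obtain ⟨x, hx, h⟩ := h
    rw [Finset.prod_eq_zero hx, mul_zero]
    rw [boundaryField, if_pos h]

theorem condProb_eq {k n : ℕ} (lam : ℝ) (σ : LocalConfig k n) (ω : Config k) :
    condProb lam σ ω = weight lam n (boundaryField ω) (support σ) /
      ∑ S ∈ indepSets k n, weight lam n (boundaryField ω) S := by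
  rw [condProb, boundaryWeight_eq_weight, ← sum_localConfig]
  simp_rw [boundaryWeight_eq_weight]

/-- The Gibbs property in terms of independent sets. -/
theorem isGibbs_iff {k : ℕ} {lam : ℝ} {μ : Measure (Config k)} :
    IsGibbs lam μ ↔ IsProbabilityMeasure μ ∧ ∀ n, ∀ S ∈ indepSets k n,
      μ (cyl n S) = ∫⁻ ω, ENNReal.ofReal (weight lam n (boundaryField ω) S /
        ∑ S' ∈ indepSets k n, weight lam n (boundaryField ω) S') ∂μ := by
  refine and_congr_right fun _ => forall_congr' fun n => ?_
  constructor
  · intro h S hS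
    obtain ⟨σ, rfl⟩ := exists_support_eq hS
    rw [← cylinder_eq_cyl, h σ]
    simp_rw [condProb_eq]
  · intro h σ
    rw [cylinder_eq_cyl, h _ (support_mem_indepSets σ)]
    simp_rw [condProb_eq]

/-- Correspondence to a collection in terms of independent sets. -/
theorem correspondsTo_iff {k : ℕ} {lam : ℝ} {z : Vertex k → ℝ} {μ : Measure (Config k)} :
    CorrespondsTo lam z μ ↔ IsProbabilityMeasure μ ∧ ∀ n, 1 ≤ n → ∀ S ∈ indepSets k n,
      μ (cyl n S) =
        ENNReal.ofReal (weight lam n z S / ∑ S' ∈ indepSets k n, weight lam n z S') := by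
  refine and_congr_right fun _ => forall_congr' fun n => imp_congr_right fun _ => ?_
  constructor
  · intro h S hS
    obtain ⟨σ, rfl⟩ := exists_support_eq hS
    rw [← cylinder_eq_cyl, h σ, finiteProb_eq]
  · intro h σ
    rw [cylinder_eq_cyl, h _ (support_mem_indepSets σ), finiteProb_eq]

/-! ### Measures on configurations -/

theorem measurable_spin {k : ℕ} (x : Vertex k) : Measurable fun ω : Config k => ω.1 x :=
  (measurable_pi_apply x).comp measurable_subtype_coe

theorem mem_cyl_iff {k n : ℕ} {S : Finset (Vertex k)} (hS : ∀ x ∈ S, depth k x ≤ n)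
    {ω : Config k} : ω ∈ cyl n S ↔ ∀ x ∈ ballFinset k n, ω.1 x = 1 ↔ x ∈ S := by
  rw [cyl, Set.mem_ofPred_eq, Finset.ext_iff]
  constructor
  · intro h x hx
    rw [← h x, mem_occupied]
    exact ⟨fun h => ⟨mem_ballFinset.mp hx, h⟩, fun h => h.2⟩
  · intro h x
    rw [mem_occupied]
    constructor
    · rintro ⟨h1, h2⟩
      exact (h x (mem_ballFinset.mpr h1)).mp h2
    · intro hx
      exact ⟨hS x hx, (h x (mem_ballFinset.mpr (hS x hx))).mpr hx⟩

theorem measurableSet_cyl {k n : ℕ} {S : Finset (Vertex k)} (hS : S ∈ indepSets k n) :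
    MeasurableSet (cyl n S) := by
  have h1 : cyl n S = ⋂ x ∈ ballFinset k n, {ω : Config k | ω.1 x = 1 ↔ x ∈ S} := by
    ext ω
    rw [mem_cyl_iff (mem_indepSets.mp hS).1]
    simp
  rw [h1]
  refine Finset.measurableSet_biInter _ fun x _ => ?_
  exact measurable_spin x (Set.to_countable {a : Fin 2 | a = 1 ↔ x ∈ S}).measurableSet

theorem lintegral_occupied {k : ℕ} (n : ℕ) (μ : Measure (Config k))
    (F : Finset (Vertex k) → ℝ≥0∞) :
    ∫⁻ ω, F (occupied n ω) ∂μ = ∑ S ∈ indepSets k n, F S * μ (cyl n S) := by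
  have h1 : ∀ ω : Config k, F (occupied n ω) =
      ∑ S ∈ indepSets k n, (cyl n S).indicator (fun _ => F S) ω := by
    intro ω
    rw [Finset.sum_eq_single_of_mem _ (occupied_mem_indepSets n ω)]
    · rw [Set.indicator_of_mem]
      rfl
    · intro S _ hS
      rw [Set.indicator_of_notMem]
      exact fun h => hS (Eq.symm h)
  simp_rw [h1]
  rw [lintegral_finsetSum' _ fun S hS =>
    (measurable_const.indicator (measurableSet_cyl hS)).aemeasurable]
  exact Finset.sum_congr rfl fun S hS => lintegral_indicator_const (measurableSet_cyl hS) _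

theorem measurableSet_occupied {k : ℕ} (n : ℕ) (P : Finset (Vertex k) → Prop) :
    MeasurableSet {ω : Config k | P (occupied n ω)} := by
  have h1 : {ω : Config k | P (occupied n ω)} =
      ⋃ S ∈ (indepSets k n).filter P, cyl n S := by
    ext ω
    simp only [Set.mem_iUnion, Finset.mem_filter, exists_prop]
    constructor
    · intro h
      exact ⟨_, ⟨occupied_mem_indepSets n ω, h⟩, rfl⟩
    · rintro ⟨S, ⟨_, h⟩, h2⟩
      have h3 : occupied n ω = S := h2
      change P (occupied n ω)
      rwa [h3]
  rw [h1]
  exact Finset.measurableSet_biUnion _ fun S hS => measurableSet_cyl (Finset.mem_filter.mp hS).1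

theorem measure_occupied {k : ℕ} (n : ℕ) (μ : Measure (Config k))
    (P : Finset (Vertex k) → Prop) [DecidablePred P] :
    μ {ω | P (occupied n ω)} = ∑ S ∈ (indepSets k n).filter P, μ (cyl n S) := by
  have := lintegral_occupied n μ fun S => if P S then 1 else 0
  rw [Finset.sum_filter]
  simp only [ite_mul, one_mul, zero_mul] at this
  rw [← this, ← lintegral_indicator_one (measurableSet_occupied n P)]
  refine lintegral_congr fun ω => ?_
  by_cases h : P (occupied n ω)
  · rw [if_pos h, Set.indicator_of_mem]
    · rfl
    · exact h
  · rw [if_neg h, Set.indicator_of_notMem]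
    exact h

theorem measure_cyl_eq_sum {k m n : ℕ} (h : m ≤ n) (μ : Measure (Config k))
    (S : Finset (Vertex k)) :
    μ (cyl m S) = ∑ R ∈ (indepSets k n).filter (fun R => truncate m R = S), μ (cyl n R) := by
  refine Eq.trans (congrArg μ ?_) (measure_occupied n μ fun R => truncate m R = S)
  ext ω
  change occupied m ω = S ↔ truncate m (occupied n ω) = S
  rw [truncate_occupied h]

theorem sum_filter_truncate_eq {M : Type*} [AddCommMonoid M] {k n : ℕ} {S : Finset (Vertex k)}
    (hS : S ∈ indepSets k n) (G : Finset (Vertex k) → M) :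
    ∑ R ∈ (indepSets k (n + 1)).filter (fun R => truncate n R = S), G R =
      ∑ T ∈ (freeSphere n S).powerset, G (S ∪ T) := by
  rw [Finset.sum_filter, sum_indepSets_succ, Finset.sum_eq_single_of_mem S hS]
  · refine Finset.sum_congr rfl fun T hT => if_pos ?_
    rw [truncate_union le_rfl ((Finset.mem_powerset.mp hT).trans (freeSphere_subset S)),
      truncate_self hS]
  · intro S' hS' hne
    refine Finset.sum_eq_zero fun T hT => if_neg ?_
    rwa [truncate_union le_rfl ((Finset.mem_powerset.mp hT).trans (freeSphere_subset S')),
      truncate_self hS']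

theorem measure_cyl_eq_sum_union {k n : ℕ} (μ : Measure (Config k)) {S : Finset (Vertex k)}
    (hS : S ∈ indepSets k n) :
    μ (cyl n S) = ∑ T ∈ (freeSphere n S).powerset, μ (cyl (n + 1) (S ∪ T)) := by
  rw [measure_cyl_eq_sum (Nat.le_succ n), sum_filter_truncate_eq hS]

theorem sum_measure_cyl {k : ℕ} (n : ℕ) (μ : Measure (Config k)) [IsProbabilityMeasure μ] :
    ∑ S ∈ indepSets k n, μ (cyl n S) = 1 := by
  have := measure_occupied n μ fun _ => True
  rw [Finset.filter_true] at this
  rw [← this]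
  exact measure_univ

/-- A measure is determined by its values on cylinders with arbitrarily large bases. -/
theorem measure_eq_of_cyl {k : ℕ} {μ ν : Measure (Config k)} [IsProbabilityMeasure μ]
    [IsProbabilityMeasure ν]
    (h : ∀ N, ∃ n, N ≤ n ∧ ∀ S ∈ indepSets k n, μ (cyl n S) = ν (cyl n S)) : μ = ν := by
  refine ext_of_generate_finite
    {s | ∃ t ∈ measurableCylinders (fun _ : Vertex k => Fin 2), (fun ω : Config k => ω.1) ⁻¹' t = s}
    ?_ (isPiSystem_measurableCylinders.comap _) ?_ (by simp)
  · change MeasurableSpace.comap _ MeasurableSpace.pi = _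
    rw [← generateFrom_measurableCylinders, MeasurableSpace.comap_generateFrom]
    rfl
  · rintro _ ⟨t, ht, rfl⟩
    obtain ⟨I, A, _, rfl⟩ := (mem_measurableCylinders t).mp ht
    obtain ⟨n, hn, hμν⟩ := h (I.sup (depth k))
    -- Since `V_n` contains `I`, the event depends only on the occupied set in `V_n`.
    obtain ⟨P, hP⟩ : ∃ P : Finset (Vertex k) → Prop,
        (fun ω : Config k => ω.1) ⁻¹' (MeasureTheory.cylinder I A) = {ω | P (occupied n ω)} := by
      refine ⟨fun S => (fun x : I => if (x : Vertex k) ∈ S then (1 : Fin 2) else 0) ∈ A, ?_⟩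
      ext ω
      rw [Set.mem_preimage, mem_cylinder, Set.mem_ofPred_eq]
      have : I.restrict ω.1 =
          fun x : I => if (x : Vertex k) ∈ occupied n ω then (1 : Fin 2) else 0 := by
        ext1 x
        have hx : depth k x ≤ n := (Finset.le_sup x.2).trans hn
        rw [fin_two_eq_iff]
        by_cases h1 : ω.1 x = 1 <;> simp [mem_occupied, hx, h1]
      rw [this]
    rw [hP, measure_occupied n μ P, measure_occupied n ν P]
    exact Finset.sum_congr rfl fun S hS => hμν S (Finset.mem_filter.mp hS).1

theorem correspondsTo_unique {k : ℕ} {lam : ℝ} {z : Vertex k → ℝ} {μ ν : Measure (Config k)}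
    (hμ : CorrespondsTo lam z μ) (hν : CorrespondsTo lam z ν) : μ = ν := by
  rw [correspondsTo_iff] at hμ hν
  obtain ⟨_, hμ⟩ := hμ
  obtain ⟨_, hν⟩ := hν
  -- Correspondence says nothing at level `0`, hence `N + 1`.
  refine measure_eq_of_cyl fun N => ⟨N + 1, Nat.le_succ N, fun S hS => ?_⟩
  rw [hμ _ (Nat.le_add_left 1 N) S hS, hν _ (Nat.le_add_left 1 N) S hS]

/-! ### Measures corresponding to a collection are Gibbs measures -/

/-- The boundary field determined by a set of occupied vertices. -/
def setField {k : ℕ} (R : Finset (Vertex k)) (x : Vertex k) : ℝ :=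
  if ∃ y ∈ children k x, y ∈ R then 0 else 1

theorem weight_boundaryField {k n : ℕ} (lam : ℝ) (ω : Config k) (S : Finset (Vertex k)) :
    weight lam n (boundaryField ω) S = weight lam n (setField (occupied (n + 1) ω)) S := by
  refine weight_congr lam S fun x hx => ?_
  rw [boundaryField, setField]
  refine if_congr (exists_congr fun y => and_congr_right fun hy => ?_) rfl rfl
  rw [mem_occupied, depth_of_mem_children hy, hx]
  simp

/-- Only `T` reaches `W_{n+1}`; the field kills `S` exactly when some vertex of `T` has its parent
in `S`. -/
theorem weight_setField {k n : ℕ} (lam : ℝ) {S' T : Finset (Vertex k)} (S : Finset (Vertex k))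
    (hS' : S' ∈ indepSets k n) (hT : T ⊆ sphereFinset k (n + 1)) :
    weight lam n (setField (S' ∪ T)) S = if T ⊆ freeSphere n S then lam ^ S.card else 0 := by
  have h1 : T ⊆ freeSphere n S ↔
      ∀ x ∈ S.filter (fun x => depth k x = n), ¬ ∃ y ∈ children k x, y ∈ S' ∪ T := by
    constructor
    · rintro h x hx ⟨y, hy, hyT⟩
      rw [Finset.mem_filter] at hx
      have hd := depth_of_mem_children hy
      rcases Finset.mem_union.mp hyT with hyS | hyT
      · have := (mem_indepSets.mp hS').1 y hyS
        omega
      · have h2 := (Finset.mem_filter.mp (h hyT)).2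
        rw [(mem_children.mp hy).2] at h2
        exact h2 hx.1
    · intro h y hy
      rw [freeSphere, Finset.mem_filter]
      refine ⟨hT hy, fun hp => ?_⟩
      have hd := mem_sphereFinset.mp (hT hy)
      have hy1 := ne_one_of_depth_eq_succ hd
      have := depth_parent hy1
      exact h (parent k y) (Finset.mem_filter.mpr ⟨hp, by omega⟩)
        ⟨y, mem_children.mpr ⟨hy1, rfl⟩, Finset.mem_union_right _ hy⟩
  rw [weight]
  split_ifs with h
  · rw [Finset.prod_eq_one, mul_one]
    intro x hx
    exact if_neg (h1.mp h x hx)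
  · rw [h1] at h
    push Not at h
    obtain ⟨x, hx, h⟩ := h
    rw [Finset.prod_eq_zero hx, mul_zero]
    exact if_pos h

theorem setField_nonneg {k : ℕ} (R : Finset (Vertex k)) (x : Vertex k) : 0 ≤ setField R x := by
  rw [setField]
  split_ifs <;> norm_num

/-- The finite form of the Gibbs equation. The kernel depends on `R = S' ∪ T` only through `T`, and
the weight of `R` factors into the kernel weight of `S'` and `∏ λ z_y` over `T`. -/
theorem sum_setField_mul_weight {k n : ℕ} {lam : ℝ} (hlam : 0 ≤ lam) (z : Vertex k → ℝ)
    {S : Finset (Vertex k)} (hS : S ∈ indepSets k n) :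
    ∑ R ∈ indepSets k (n + 1), weight lam n (setField R) S /
        (∑ S' ∈ indepSets k n, weight lam n (setField R) S') * weight lam (n + 1) z R =
      ∑ T ∈ (freeSphere n S).powerset, weight lam (n + 1) z (S ∪ T) := by
  have hsub : ∀ S : Finset (Vertex k), (freeSphere n S).powerset =
      (sphereFinset k (n + 1)).powerset.filter fun T => T ⊆ freeSphere n S := by
    intro S
    ext T
    rw [Finset.mem_powerset, Finset.mem_filter, Finset.mem_powerset]
    exact ⟨fun h => ⟨h.trans (freeSphere_subset S), h⟩, fun h => h.2⟩
  have h0 : ∀ T ⊆ sphereFinset k (n + 1), ∀ S' ∈ indepSets k n, ∀ S : Finset (Vertex k),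
      weight lam n (setField (S' ∪ T)) S = weight lam n (setField T) S := by
    intro T hT S' hS' S
    rw [weight_setField lam S hS' hT, ← weight_setField lam S (empty_mem_indepSets k n) hT,
      Finset.empty_union]
  have h1 : ∀ T ⊆ sphereFinset k (n + 1), ∀ S ∈ indepSets k n,
      (if T ⊆ freeSphere n S then weight lam (n + 1) z (S ∪ T) else 0) =
        weight lam n (setField T) S * ∏ y ∈ T, (lam * z y) := by
    intro T hT S hS
    rw [← h0 T hT S hS, weight_setField lam S hS hT, weight_union lam z hS hT]
    split_ifs <;> simp
  rw [sum_indepSets_succ]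
  calc ∑ S' ∈ indepSets k n, ∑ T ∈ (freeSphere n S').powerset,
        weight lam n (setField (S' ∪ T)) S /
          (∑ S'' ∈ indepSets k n, weight lam n (setField (S' ∪ T)) S'') *
            weight lam (n + 1) z (S' ∪ T)
      = ∑ S' ∈ indepSets k n, ∑ T ∈ (sphereFinset k (n + 1)).powerset,
        weight lam n (setField T) S /
          (∑ S'' ∈ indepSets k n, weight lam n (setField T) S'') *
            (weight lam n (setField T) S' * ∏ y ∈ T, (lam * z y)) := by
        refine Finset.sum_congr rfl fun S' hS' => ?_
        rw [hsub, Finset.sum_filter]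
        refine Finset.sum_congr rfl fun T hT => ?_
        have hT' := Finset.mem_powerset.mp hT
        rw [← h1 T hT' S' hS']
        simp_rw [h0 T hT' S' hS']
        split_ifs <;> simp
    _ = ∑ T ∈ (sphereFinset k (n + 1)).powerset,
        weight lam n (setField T) S * ∏ y ∈ T, (lam * z y) := by
        -- With the sum over `S'` innermost, it reproduces the normalising constant of the kernel,
        -- which cancels.
        rw [Finset.sum_comm]
        refine Finset.sum_congr rfl fun T _ => ?_
        rw [← Finset.mul_sum, ← Finset.sum_mul]
        have := (sum_weight_pos (n := n) hlam fun x _ => setField_nonneg T x).ne'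
        field_simp
    _ = _ := by
        rw [hsub, Finset.sum_filter]
        exact Finset.sum_congr rfl fun T hT =>
          (h1 T (Finset.mem_powerset.mp hT) S hS).symm

/-- Both sides are finite sums over `V_{n+1}`. Only level `n + 1 ≥ 1` of the correspondence is
needed, so `n = 0` is included, and consistency comes from `μ` itself rather than from the
recursion. -/
theorem CorrespondsTo.isGibbs {k : ℕ} {lam : ℝ} (hlam : 0 < lam) {z : Vertex k → ℝ}
    (hz : ∀ x, 0 < z x) {μ : Measure (Config k)} (h : CorrespondsTo lam z μ) :
    IsGibbs lam μ := by
  rw [correspondsTo_iff] at h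
  rw [isGibbs_iff]
  refine ⟨h.1, fun n S hS => ?_⟩
  have h1 : ∀ R ∈ indepSets k (n + 1), μ (cyl (n + 1) R) = ENNReal.ofReal
      (weight lam (n + 1) z R / ∑ R' ∈ indepSets k (n + 1), weight lam (n + 1) z R') :=
    h.2 _ (Nat.le_add_left 1 n)
  set Z := ∑ R' ∈ indepSets k (n + 1), weight lam (n + 1) z R' with hZ
  have hZpos : 0 < Z := sum_weight_pos hlam.le fun x _ => (hz x).le
  have hw : ∀ R, 0 ≤ weight lam (n + 1) z R / Z := fun R =>
    div_nonneg (weight_nonneg hlam.le (fun x _ => (hz x).le) R) hZpos.le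
  have hg : ∀ R, 0 ≤ weight lam n (setField R) S /
      ∑ S' ∈ indepSets k n, weight lam n (setField R) S' := fun R =>
    div_nonneg (weight_nonneg hlam.le (fun x _ => setField_nonneg R x) S)
      (sum_weight_pos hlam.le fun x _ => setField_nonneg R x).le
  have hl : μ (cyl n S) = ENNReal.ofReal
      (∑ T ∈ (freeSphere n S).powerset, weight lam (n + 1) z (S ∪ T) / Z) := by
    rw [measure_cyl_eq_sum_union μ hS, ENNReal.ofReal_sum_of_nonneg fun T _ => hw _]
    exact Finset.sum_congr rfl fun T hT => h1 _ (union_mem_indepSets hS (Finset.mem_powerset.mp hT))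
  simp_rw [weight_boundaryField]
  rw [lintegral_occupied (n + 1) μ fun R => ENNReal.ofReal (weight lam n (setField R) S /
      ∑ S' ∈ indepSets k n, weight lam n (setField R) S'), hl, ← Finset.sum_div,
    ← sum_setField_mul_weight hlam.le z hS, Finset.sum_div]
  simp_rw [mul_div_assoc]
  rw [ENNReal.ofReal_sum_of_nonneg fun R _ => mul_nonneg (hg R) (hw R)]
  exact Finset.sum_congr rfl fun R hR => by rw [h1 R hR, ENNReal.ofReal_mul (hg R)]

/-! ### Existence of the measure corresponding to a solution of the recursion -/

/-- The recursive construction of the spin at `x` at distance `n` from the root: `x` is occupied iff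
`b x` holds and its parent is not occupied. -/
def spinAux {k : ℕ} (b : Vertex k → Bool) : ℕ → Vertex k → Bool
  | 0, x => b x
  | n + 1, x => b x && !spinAux b n (parent k x)

/-- Whether `x` is occupied in the configuration generated by `b`. -/
def spin {k : ℕ} (b : Vertex k → Bool) (x : Vertex k) : Bool := spinAux b (depth k x) x

theorem spin_one {k : ℕ} (b : Vertex k → Bool) : spin b 1 = b 1 := by
  rw [spin, depth_one, spinAux]

theorem spin_of_ne_one {k : ℕ} (b : Vertex k → Bool) {x : Vertex k} (hx : x ≠ 1) :
    spin b x = (b x && !spin b (parent k x)) := by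
  rw [spin, depth_parent hx, spinAux, spin]

/-- The configuration generated by `b`. -/
def generate {k : ℕ} (b : Vertex k → Bool) : Config k :=
  ⟨fun x => if spin b x then 1 else 0, by
    have aux : ∀ x y : Vertex k, x ≠ 1 → parent k x = y → spin b x = true → spin b y = true →
        False := by
      rintro x _ hx rfl h1 h2
      rw [spin_of_ne_one b hx, h2] at h1
      simp at h1
    intro x y hxy
    rw [fin_two_mul_eq_zero_iff]
    rintro ⟨h1, h2⟩
    have h1' : spin b x = true := by
      by_contra h
      simp [h] at h1
    have h2' : spin b y = true := by
      by_contra h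
      simp [h] at h2
    rcases adj_iff_parent.mp hxy with ⟨h3, h4⟩ | ⟨h3, h4⟩
    · exact aux x y h3 h4 h1' h2'
    · exact aux y x h3 h4 h2' h1'⟩

theorem generate_eq_one_iff {k : ℕ} (b : Vertex k → Bool) (x : Vertex k) :
    (generate b).1 x = 1 ↔ spin b x = true := by
  change (if spin b x then (1 : Fin 2) else 0) = 1 ↔ _
  by_cases h : spin b x = true <;> simp [h]

theorem measurable_generate (k : ℕ) : Measurable (generate (k := k)) := by
  have h1 : ∀ n (x : Vertex k), Measurable fun b : Vertex k → Bool => spinAux b n x := by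
    intro n
    induction n with
    | zero => exact fun x => measurable_pi_apply x
    | succ n ih =>
      intro x
      have h2 : Measurable fun p : Bool × Bool => p.1 && !p.2 := measurable_of_countable _
      exact h2.comp ((measurable_pi_apply x).prodMk (ih (parent k x)))
  refine Measurable.subtype_mk (measurable_pi_lambda _ fun x => ?_)
  have h2 : Measurable fun c : Bool => if c then (1 : Fin 2) else 0 := measurable_of_countable _
  exact h2.comp (h1 (depth k x) x)

/-- The vertices of `V_n` whose parent is not in `S`, and the root. -/
def freeBall {k : ℕ} (n : ℕ) (S : Finset (Vertex k)) : Finset (Vertex k) :=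
  (ballFinset k n).filter fun x => x = 1 ∨ parent k x ∉ S

/-- A vertex with an occupied parent is empty whatever its coin shows, and it is not in `S` because
`S` is independent. Only the coins in `freeBall n S` are constrained, so the event is a box. -/
theorem preimage_generate_cyl {k n : ℕ} {S : Finset (Vertex k)} (hS : S ∈ indepSets k n) :
    generate ⁻¹' cyl n S = Set.pi (freeBall n S : Finset (Vertex k)) fun x => {decide (x ∈ S)} := by
  rw [mem_indepSets] at hS
  ext b
  rw [Set.mem_preimage, mem_cyl_iff hS.1]
  simp_rw [generate_eq_one_iff]
  simp only [Set.mem_pi, Finset.mem_coe, Set.mem_singleton_iff]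
  constructor
  · intro h x hx
    rw [freeBall, Finset.mem_filter] at hx
    obtain ⟨hx, hx2⟩ := hx
    rw [Bool.eq_iff_iff, decide_eq_true_iff, ← h x hx]
    by_cases h1 : x = 1
    · rw [h1, spin_one]
    · have hp : parent k x ∉ S := hx2.resolve_left h1
      have hpb : parent k x ∈ ballFinset k n := by
        rw [mem_ballFinset] at hx ⊢
        have := depth_parent h1
        omega
      rw [← h _ hpb] at hp
      rw [spin_of_ne_one b h1]
      simp [hp]
  · intro h x hx
    have key : ∀ d, ∀ x : Vertex k, depth k x = d → d ≤ n → (spin b x = true ↔ x ∈ S) := by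
      intro d
      induction d with
      | zero =>
        intro x hx hd
        rw [depth_eq_zero_iff] at hx
        subst hx
        rw [spin_one, h 1, decide_eq_true_iff]
        rw [freeBall, Finset.mem_filter, mem_ballFinset, depth_one]
        exact ⟨hd, Or.inl rfl⟩
      | succ d ih =>
        intro x hx hd
        have h1 := ne_one_of_depth_eq_succ hx
        have hp := depth_parent h1
        have ih' := ih (parent k x) (by omega) (by omega)
        rw [spin_of_ne_one b h1]
        by_cases hpS : parent k x ∈ S
        · have hxS : x ∉ S := fun hxS => hS.2 x hxS h1 hpS
          rw [ih'.mpr hpS]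
          simp [hxS]
        · have hsp : spin b (parent k x) = false := by
            rw [← ih'] at hpS
            simpa using hpS
          rw [hsp, h x]
          · simp
          · rw [freeBall, Finset.mem_filter, mem_ballFinset, hx]
            exact ⟨hd, Or.inr hpS⟩
    exact key _ x rfl (mem_ballFinset.mp hx)

/-- The probability measure on `{true, false}` with odds `t : 1`. -/
def oddsMeasure (t : ℝ) : Measure Bool :=
  ENNReal.ofReal (t * (1 + t)⁻¹) • Measure.dirac true +
    ENNReal.ofReal ((1 + t)⁻¹) • Measure.dirac false

theorem oddsMeasure_singleton (t : ℝ) (c : Bool) :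
    oddsMeasure t {c} = ENNReal.ofReal ((if c = true then t else 1) * (1 + t)⁻¹) := by
  cases c <;> simp [oddsMeasure]

theorem isProbabilityMeasure_oddsMeasure {t : ℝ} (ht : 0 ≤ t) :
    IsProbabilityMeasure (oddsMeasure t) := by
  constructor
  have h1 : (0 : ℝ) < 1 + t := by linarith
  rw [oddsMeasure]
  simp only [Measure.coe_add, Measure.coe_smul, Pi.add_apply, Pi.smul_apply, measure_univ,
    smul_eq_mul, mul_one]
  rw [← ENNReal.ofReal_add (by positivity) (by positivity), ← ENNReal.ofReal_one]
  congr 1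
  field_simp
  ring

/-- The vertices left out of `freeBall` are those whose parent lies in `S`. Grouped by parent `x`,
their factors `(1 + λ z_y)⁻¹` multiply to `z_x` by the recursion, which absorbs the fields of `S` at
depth below `n` and leaves those on `W_n`. -/
theorem prod_freeBall {k n : ℕ} {lam : ℝ} {z : Vertex k → ℝ} (hz : ∀ x, z x = step lam z x)
    {S : Finset (Vertex k)} (hS : S ∈ indepSets k n) :
    ∏ x ∈ freeBall n S, (if x ∈ S then lam * z x else 1) * (1 + lam * z x)⁻¹ =
      (∏ x ∈ ballFinset k n, (1 + lam * z x)⁻¹) * weight lam n z S := by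
  rw [mem_indepSets] at hS
  have h1 : ∏ x ∈ freeBall n S, (if x ∈ S then lam * z x else 1) = ∏ x ∈ S, lam * z x := by
    rw [← Finset.prod_filter]
    refine Finset.prod_congr ?_ fun _ _ => rfl
    ext x
    rw [Finset.mem_filter, freeBall, Finset.mem_filter, mem_ballFinset]
    constructor
    · exact fun h => h.2
    · intro h
      refine ⟨⟨hS.1 x h, ?_⟩, h⟩
      by_cases hx : x = 1
      · exact Or.inl hx
      · exact Or.inr (hS.2 x h hx)
  have h2 : ∏ x ∈ S.filter (fun x => ¬ depth k x = n), z x =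
      ∏ y ∈ (ballFinset k n).filter (fun y => ¬ (y = 1 ∨ parent k y ∉ S)),
        (1 + lam * z y)⁻¹ := by
    symm
    rw [← Finset.prod_fiberwise_of_maps_to (g := parent k)
      (t := S.filter (fun x => ¬ depth k x = n))]
    · refine Finset.prod_congr rfl fun x hx => ?_
      rw [hz x, step]
      symm
      refine Finset.prod_congr ?_ fun _ _ => rfl
      rw [Finset.mem_filter] at hx
      ext y
      rw [Finset.mem_filter, Finset.mem_filter, mem_ballFinset, mem_children]
      constructor
      · rintro ⟨h3, h4⟩
        have := depth_parent h3
        have := hS.1 x hx.1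
        rw [h4] at *
        refine ⟨⟨by omega, ?_⟩, rfl⟩
        rw [not_or, not_not]
        exact ⟨h3, hx.1⟩
      · rintro ⟨⟨_, h3⟩, h4⟩
        exact ⟨(not_or.mp h3).1, h4⟩
    · intro y hy
      rw [Finset.mem_filter, mem_ballFinset, not_or, not_not] at hy
      rw [Finset.mem_filter]
      have := depth_parent hy.2.1
      exact ⟨hy.2.2, by omega⟩
  rw [Finset.prod_mul_distrib, h1, Finset.prod_mul_distrib, Finset.prod_const, weight,
    ← Finset.prod_filter_mul_prod_filter_not S (fun x => depth k x = n) z, h2,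
    ← Finset.prod_filter_mul_prod_filter_not (ballFinset k n) (fun x => x = 1 ∨ parent k x ∉ S)
      fun x => (1 + lam * z x)⁻¹, freeBall]
  ring

theorem exists_measure_cyl {k : ℕ} {lam : ℝ} (hlam : 0 < lam) {z : Vertex k → ℝ}
    (hpos : ∀ x, 0 < z x) (hz : ∀ x, z x = step lam z x) :
    ∃ μ : Measure (Config k), IsProbabilityMeasure μ ∧ ∀ n, ∀ S ∈ indepSets k n,
      μ (cyl n S) =
        ENNReal.ofReal ((∏ x ∈ ballFinset k n, (1 + lam * z x)⁻¹) * weight lam n z S) := by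
  have hprob : ∀ x, IsProbabilityMeasure (oddsMeasure (lam * z x)) := fun x =>
    isProbabilityMeasure_oddsMeasure (mul_pos hlam (hpos x)).le
  refine ⟨(Measure.infinitePi fun x => oddsMeasure (lam * z x)).map generate,
    Measure.isProbabilityMeasure_map (measurable_generate k).aemeasurable, fun n S hS => ?_⟩
  rw [Measure.map_apply (measurable_generate k) (measurableSet_cyl hS), preimage_generate_cyl hS,
    Measure.infinitePi_pi _ fun _ _ => measurableSet_singleton _, ← prod_freeBall hz hS,
    ENNReal.ofReal_prod_of_nonneg]
  · refine Finset.prod_congr rfl fun x _ => ?_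
    rw [oddsMeasure_singleton]
    simp
  · intro x _
    have := mul_pos hlam (hpos x)
    split_ifs <;> positivity

theorem step_congr {k : ℕ} {lam : ℝ} {z z' : Vertex k → ℝ} (h : ∀ x, x ≠ 1 → z x = z' x)
    (x : Vertex k) : step lam z x = step lam z' x :=
  Finset.prod_congr rfl fun y hy => by rw [h y (mem_children.mp hy).1]

/-- The constant `C` need not be computed, since total mass one determines it. -/
theorem correspondsTo_of_proportional {k : ℕ} {lam : ℝ} (hlam : 0 < lam) {z : Vertex k → ℝ}
    (hpos : ∀ x, 0 < z x) {μ : Measure (Config k)} [IsProbabilityMeasure μ]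
    (h : ∀ n, 1 ≤ n → ∃ C : ℝ, 0 ≤ C ∧ ∀ S ∈ indepSets k n,
      μ (cyl n S) = ENNReal.ofReal (C * weight lam n z S)) : CorrespondsTo lam z μ := by
  refine correspondsTo_iff.mpr ⟨inferInstance, fun n hn S hS => ?_⟩
  obtain ⟨C, hC, hcyl⟩ := h n hn
  have hsum := sum_measure_cyl n μ
  rw [Finset.sum_congr rfl fun S hS => hcyl S hS,
    ← ENNReal.ofReal_sum_of_nonneg fun S _ => mul_nonneg hC
      (weight_nonneg hlam.le (fun x _ => (hpos x).le) S), ENNReal.ofReal_eq_one,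
    ← Finset.mul_sum] at hsum
  rw [hcyl S hS, eq_one_div_of_mul_eq_one_left hsum]
  congr 1
  ring

theorem exists_correspondsTo {k : ℕ} {lam : ℝ} (hlam : 0 < lam) {z : Vertex k → ℝ}
    (hpos : ∀ x, 0 < z x) (hz : ∀ x, x ≠ 1 → z x = step lam z x) :
    ∃ μ : Measure (Config k), CorrespondsTo lam z μ := by
  -- The coin construction needs the equation at the root too. The root is nobody's child and does
  -- not lie on `W_n` for `n ≥ 1`, so its value can be chosen to satisfy it.
  set z' := Function.update z 1 (step lam z 1) with hz'
  have h1 : ∀ x, x ≠ 1 → z' x = z x := fun x hx => Function.update_of_ne hx _ _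
  have h2 : z' 1 = step lam z 1 := Function.update_self _ _ _
  have hpos' : ∀ x, 0 < z' x := by
    intro x
    by_cases hx : x = 1
    · rw [hx, h2]
      exact Finset.prod_pos fun y _ => inv_pos.mpr (by have := mul_pos hlam (hpos y); linarith)
    · rw [h1 x hx]
      exact hpos x
  have hstep : ∀ x, z' x = step lam z' x := by
    intro x
    rw [step_congr h1]
    by_cases hx : x = 1
    · rw [hx, h2]
    · rw [h1 x hx, hz x hx]
  obtain ⟨μ, hμ, hcyl⟩ := exists_measure_cyl hlam hpos' hstep
  refine ⟨μ, correspondsTo_of_proportional hlam hpos fun n hn =>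
    ⟨∏ x ∈ ballFinset k n, (1 + lam * z' x)⁻¹, ?_, fun S hS => ?_⟩⟩
  · refine Finset.prod_nonneg fun y _ => inv_nonneg.mpr ?_
    have := mul_pos hlam (hpos' y)
    linarith
  · rw [hcyl n S hS, weight_congr lam S fun x hx => h1 x ?_]
    rintro rfl
    rw [depth_one] at hx
    omega

/-! ### The collection is determined by the measure -/

theorem singleton_mem_indepSets {k n : ℕ} {x : Vertex k} (hx : depth k x = n) :
    {x} ∈ indepSets k n := by
  rw [mem_indepSets]
  constructor
  · intro y hy
    rw [Finset.mem_singleton.mp hy, hx]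
  · intro y hy h1 h2
    have := depth_parent h1
    rw [Finset.mem_singleton.mp h2, Finset.mem_singleton.mp hy] at this
    omega

theorem CorrespondsTo.real_cyl {k n : ℕ} {lam : ℝ} (hlam : 0 < lam) {z : Vertex k → ℝ}
    (hpos : ∀ x, 0 < z x) {μ : Measure (Config k)} (h : CorrespondsTo lam z μ) (hn : 1 ≤ n)
    {S : Finset (Vertex k)} (hS : S ∈ indepSets k n) :
    μ.real (cyl n S) = weight lam n z S / ∑ S' ∈ indepSets k n, weight lam n z S' := by
  rw [measureReal_def, (correspondsTo_iff.mp h).2 n hn S hS, ENNReal.toReal_ofReal]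
  exact div_nonneg (weight_pos hlam (fun x _ => hpos x) S).le
    (sum_weight_pos hlam.le fun x _ => (hpos x).le).le

/-- At level `depth k x` the probabilities of `{x}` and `∅` have ratio `λ z_x`. The level must be at
least `1`, which excludes the root. -/
theorem CorrespondsTo.eq_of_ne_one {k : ℕ} {lam : ℝ} (hlam : 0 < lam) {z z' : Vertex k → ℝ}
    (hpos : ∀ x, 0 < z x) (hpos' : ∀ x, 0 < z' x) {μ : Measure (Config k)}
    (h : CorrespondsTo lam z μ) (h' : CorrespondsTo lam z' μ) {x : Vertex k} (hx : x ≠ 1) :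
    z x = z' x := by
  have hn : 1 ≤ depth k x := by
    rw [depth_parent hx]
    omega
  have hw : ∀ z : Vertex k → ℝ, weight lam (depth k x) z {x} = lam * z x := by
    intro z
    rw [weight, Finset.filter_singleton, if_pos rfl, Finset.prod_singleton,
      Finset.card_singleton, pow_one]
  have key : ∀ z : Vertex k → ℝ, (∀ x, 0 < z x) → CorrespondsTo lam z μ →
      μ.real (cyl (depth k x) {x}) = lam * z x * μ.real (cyl (depth k x) ∅) := by
    intro z hz h
    rw [h.real_cyl hlam hz hn (singleton_mem_indepSets rfl),
      h.real_cyl hlam hz hn (empty_mem_indepSets _ _), hw, weight_empty]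
    ring
  have h0 : μ.real (cyl (depth k x) ∅) ≠ 0 := by
    rw [h.real_cyl hlam hpos hn (empty_mem_indepSets _ _), weight_empty]
    exact (div_pos one_pos (sum_weight_pos hlam.le fun x _ => (hpos x).le)).ne'
  have h1 := (key z hpos h).symm.trans (key z' hpos' h')
  exact mul_left_cancel₀ hlam.ne' (mul_right_cancel₀ h0 h1)

theorem one_add_mul_pos {lam t : ℝ} (hlam : 0 < lam) (ht : 0 ≤ t) : 0 < 1 + lam * t := by
  positivity

theorem step_pos {k : ℕ} {lam : ℝ} (hlam : 0 < lam) {z : Vertex k → ℝ} (hpos : ∀ x, 0 < z x)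
    (x : Vertex k) : 0 < step lam z x :=
  Finset.prod_pos fun y _ => inv_pos.mpr (one_add_mul_pos hlam (hpos y).le)

/-- Restricting from `V_{n+1}` to `V_n` sums out one sphere. As the collection is determined off the
root, this yields the fixed-point equation. -/
theorem CorrespondsTo.step {k : ℕ} {lam : ℝ} (hlam : 0 < lam) {z : Vertex k → ℝ}
    (hpos : ∀ x, 0 < z x) {μ : Measure (Config k)} (h : CorrespondsTo lam z μ) :
    CorrespondsTo lam (step lam z) μ := by
  obtain ⟨hμ, h⟩ := correspondsTo_iff.mp h
  refine correspondsTo_of_proportional hlam (step_pos hlam hpos) fun n hn =>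
    ⟨(∏ y ∈ sphereFinset k (n + 1), (1 + lam * z y)) /
      ∑ S' ∈ indepSets k (n + 1), weight lam (n + 1) z S', ?_, fun S hS => ?_⟩
  · exact div_nonneg (Finset.prod_nonneg fun y _ => (one_add_mul_pos hlam (hpos y).le).le)
      (sum_weight_pos hlam.le fun x _ => (hpos x).le).le
  · rw [div_mul_eq_mul_div, ← sum_weight_union
      (fun x _ => (one_add_mul_pos hlam (hpos x).le).ne') hS, Finset.sum_div,
      ENNReal.ofReal_sum_of_nonneg, measure_cyl_eq_sum_union μ hS]
    · exact Finset.sum_congr rfl fun T hT =>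
        h _ (Nat.le_add_left 1 n) _ (union_mem_indepSets hS (Finset.mem_powerset.mp hT))
    · exact fun T _ => div_nonneg (weight_pos hlam (fun x _ => hpos x) _).le
        (sum_weight_pos hlam.le fun x _ => (hpos x).le).le

theorem CorrespondsTo.eq_step {k : ℕ} {lam : ℝ} (hlam : 0 < lam) {z : Vertex k → ℝ}
    (hpos : ∀ x, 0 < z x) {μ : Measure (Config k)} (h : CorrespondsTo lam z μ) {x : Vertex k}
    (hx : x ≠ 1) : z x = HardCore.step lam z x :=
  h.eq_of_ne_one hlam hpos (step_pos hlam hpos) (h.step hlam hpos) hx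

/-! ### Bounds on the effective boundary fields -/

/-- The recursion for constant boundary fields. -/
def fieldMap (k : ℕ) (lam t : ℝ) : ℝ := ((1 + lam * t) ^ k)⁻¹

theorem fieldMap_pos (k : ℕ) {lam t : ℝ} (hlam : 0 < lam) (ht : 0 ≤ t) :
    0 < fieldMap k lam t := by
  rw [fieldMap]
  positivity

theorem fieldMap_anti (k : ℕ) {lam s t : ℝ} (hlam : 0 < lam) (hs : 0 ≤ s) (hst : s ≤ t) :
    fieldMap k lam t ≤ fieldMap k lam s := by
  rw [fieldMap, fieldMap]
  gcongr

/-- The map on bounds for the boundary fields that is induced by the recursion. -/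
def boundMap (k : ℕ) (lam : ℝ) (p : ℝ × ℝ) : ℝ × ℝ := (fieldMap k lam p.2, fieldMap k lam p.1)

/-- Each factor decreases in the child's field, so an upper bound on the children is a lower bound
at the parent; hence the swap in `boundMap`. -/
theorem fieldMap_le_step {k : ℕ} {lam b : ℝ} (hlam : 0 < lam) {z : Vertex k → ℝ}
    {x : Vertex k} (h0 : ∀ y ∈ children k x, 0 ≤ z y) (hb : ∀ y ∈ children k x, z y ≤ b)
    (hx : x ≠ 1) : fieldMap k lam b ≤ step lam z x := by
  have h1 := Finset.prod_le_prod (s := children k x) (f := fun _ => (1 + lam * b)⁻¹)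
    (g := fun y => (1 + lam * z y)⁻¹) (fun y hy => by
      have := (h0 y hy).trans (hb y hy)
      positivity) fun y hy => by
      have := h0 y hy
      have := hb y hy
      gcongr
  rwa [Finset.prod_const, card_children hx, inv_pow] at h1

theorem step_le_fieldMap {k : ℕ} {lam a : ℝ} (hlam : 0 < lam) (ha : 0 ≤ a) {z : Vertex k → ℝ}
    {x : Vertex k} (h : ∀ y ∈ children k x, a ≤ z y) (hx : x ≠ 1) :
    step lam z x ≤ fieldMap k lam a := by
  have h1 := Finset.prod_le_prod (s := children k x) (f := fun y => (1 + lam * z y)⁻¹)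
    (g := fun _ => (1 + lam * a)⁻¹) (fun y hy => by
      have := ha.trans (h y hy)
      positivity) fun y hy => by
      have := h y hy
      gcongr
  rwa [Finset.prod_const, card_children hx, inv_pow] at h1

theorem sum_filter_truncate_succ {M : Type*} [AddCommMonoid M] {k m n : ℕ} (hmn : m ≤ n)
    (S : Finset (Vertex k)) (G : Finset (Vertex k) → M) :
    ∑ R ∈ (indepSets k (n + 1)).filter (fun R => truncate m R = S), G R =
      ∑ R ∈ (indepSets k n).filter (fun R => truncate m R = S),
        ∑ T ∈ (freeSphere n R).powerset, G (R ∪ T) := by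
  rw [Finset.sum_filter, sum_indepSets_succ, Finset.sum_filter]
  refine Finset.sum_congr rfl fun R _ => ?_
  have h1 : ∀ T ∈ (freeSphere n R).powerset, truncate m (R ∪ T) = truncate m R := fun T hT =>
    truncate_union hmn ((Finset.mem_powerset.mp hT).trans (freeSphere_subset R))
  split_ifs with h
  · exact Finset.sum_congr rfl fun T hT => if_pos ((h1 T hT).trans h)
  · exact Finset.sum_eq_zero fun T hT => if_neg fun h2 => h ((h1 T hT).symm.trans h2)

/-- Summing out the spins in `V_{m+j} \ V_m` leaves an effective field on `W_m`, with bounds that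
only depend on `j` and on the bounds for the field on `W_{m+j}`. -/
theorem exists_effective_field {k m : ℕ} {lam : ℝ} (hlam : 0 < lam) (j : ℕ) :
    ∀ (a b : ℝ) (z : Vertex k → ℝ), 0 ≤ a → (∀ x, 0 ≤ z x) →
      (∀ x, x ≠ 1 → a ≤ z x ∧ z x ≤ b) →
      ∃ K : ℝ, 0 ≤ K ∧ ∃ z' : Vertex k → ℝ,
        (∀ x, x ≠ 1 → 0 ≤ ((boundMap k lam)^[j] (a, b)).1 ∧
          ((boundMap k lam)^[j] (a, b)).1 ≤ z' x) ∧
        ∀ S ∈ indepSets k m, ∑ R ∈ (indepSets k (m + j)).filter (fun R => truncate m R = S),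
          weight lam (m + j) z R = K * weight lam m z' S := by
  induction j with
  | zero =>
    intro a b z ha _ hab
    refine ⟨1, zero_le_one, z, fun x hx => ⟨ha, (hab x hx).1⟩, fun S hS => ?_⟩
    rw [one_mul, add_zero, Finset.sum_filter, Finset.sum_eq_single_of_mem S hS]
    · exact if_pos (truncate_self hS)
    · intro R hR hne
      refine if_neg ?_
      rwa [truncate_self hR]
  | succ j ih =>
    intro a b z ha h0 hab
    have hch : ∀ x : Vertex k, ∀ y ∈ children k x, a ≤ z y ∧ z y ≤ b := fun x y hy =>
      hab y (mem_children.mp hy).1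
    have hstep0 : ∀ x, 0 ≤ step lam z x := fun x =>
      Finset.prod_nonneg fun y _ => inv_nonneg.mpr (one_add_mul_pos hlam (h0 y)).le
    have hb0 : 0 ≤ b := by
      have := hab (gen k 0) (gen_ne_one k 0)
      linarith
    -- The outermost sphere is summed out first; the induction hypothesis then treats the new field
    -- with the bounds `boundMap k lam (a, b)`.
    obtain ⟨K, hK, z', hz', hsum⟩ := ih (fieldMap k lam b) (fieldMap k lam a) (step lam z)
      (fieldMap_pos k hlam hb0).le hstep0 fun x hx =>
        ⟨fieldMap_le_step hlam (fun y _ => h0 y) (fun y hy => (hch x y hy).2) hx,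
          step_le_fieldMap hlam ha (fun y hy => (hch x y hy).1) hx⟩
    refine ⟨(∏ y ∈ sphereFinset k (m + j + 1), (1 + lam * z y)) * K, mul_nonneg
      (Finset.prod_nonneg fun y _ => (one_add_mul_pos hlam (h0 y)).le) hK, z', ?_, ?_⟩
    · rw [Function.iterate_succ_apply]
      exact hz'
    · intro S hS
      rw [← add_assoc, sum_filter_truncate_succ (Nat.le_add_right m j),
        Finset.sum_congr rfl fun R hR => sum_weight_union
          (fun x _ => (one_add_mul_pos hlam (h0 x)).ne') (Finset.mem_filter.mp hR).1,
        ← Finset.mul_sum, hsum S hS, mul_assoc]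

theorem measurable_occupied {k : ℕ} (n : ℕ) (F : Finset (Vertex k) → ℝ≥0∞) :
    Measurable fun ω : Config k => F (occupied n ω) :=
  fun s _ => measurableSet_occupied n fun S => F S ∈ s

theorem boundaryField_mem {k : ℕ} (ω : Config k) (x : Vertex k) :
    0 ≤ boundaryField ω x ∧ boundaryField ω x ≤ 1 := by
  rw [boundaryField]
  split_ifs <;> norm_num

/-- A lower bound for the cylinder probabilities of a Gibbs measure relative to the probability of
the empty configuration. -/
theorem IsGibbs.weight_mul_le {k m : ℕ} {lam : ℝ} (hlam : 0 < lam) (hm : 1 ≤ m)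
    {ν : Measure (Config k)} (hν : IsGibbs lam ν) (j : ℕ) {S : Finset (Vertex k)}
    (hS : S ∈ indepSets k m) :
    weight lam m (fun _ => ((boundMap k lam)^[j] (0, 1)).1) S * ν.real (cyl m ∅) ≤
      ν.real (cyl m S) := by
  obtain ⟨hprob, hν⟩ := isGibbs_iff.mp hν
  set l := ((boundMap k lam)^[j] (0, 1)).1 with hl
  set g : Config k → Finset (Vertex k) → ℝ := fun ω R => weight lam (m + j) (boundaryField ω) R /
    ∑ S' ∈ indepSets k (m + j), weight lam (m + j) (boundaryField ω) S' with hg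
  have hb0 : ∀ (ω : Config k) x, 0 ≤ boundaryField ω x := fun ω x => (boundaryField_mem ω x).1
  have hg0 : ∀ ω R, 0 ≤ g ω R := fun ω R =>
    div_nonneg (weight_nonneg hlam.le (fun x _ => hb0 ω x) R)
      (sum_weight_pos hlam.le fun x _ => hb0 ω x).le
  have hmeas : ∀ R, Measurable fun ω => ENNReal.ofReal (g ω R) := by
    intro R
    simp_rw [hg, weight_boundaryField]
    exact measurable_occupied (m + j + 1) fun Q => ENNReal.ofReal
      (weight lam (m + j) (setField Q) R /
        ∑ S' ∈ indepSets k (m + j), weight lam (m + j) (setField Q) S')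
  have hint : ∀ S : Finset (Vertex k), ν (cyl m S) = ∫⁻ ω, ENNReal.ofReal
      (∑ R ∈ (indepSets k (m + j)).filter (fun R => truncate m R = S), g ω R) ∂ν := by
    intro S
    simp_rw [ENNReal.ofReal_sum_of_nonneg fun R _ => hg0 _ R]
    rw [lintegral_finsetSum _ fun R _ => hmeas R, measure_cyl_eq_sum (Nat.le_add_right m j)]
    exact Finset.sum_congr rfl fun R hR => hν _ R (Finset.mem_filter.mp hR).1
  -- The zero field is a convenient instance from which to read off the sign of the iterate.
  have hl0 : 0 ≤ l := by
    obtain ⟨_, _, z', hz', _⟩ := exists_effective_field (k := k) (m := m) hlam j 0 1 (fun _ => 0)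
      le_rfl (fun _ => le_rfl) fun _ _ => ⟨le_rfl, zero_le_one⟩
    exact (hz' (gen k 0) (gen_ne_one k 0)).1
  have hw0 : 0 ≤ weight lam m (fun _ => l) S := weight_nonneg hlam.le (fun _ _ => hl0) S
  -- For a fixed boundary condition, `S` and `∅` share the constant `K` and the normaliser; their
  -- ratio is the weight of an effective field that is at least `l` on `W_m`.
  have hpt : ∀ ω, weight lam m (fun _ => l) S *
      ∑ R ∈ (indepSets k (m + j)).filter (fun R => truncate m R = ∅), g ω R ≤
      ∑ R ∈ (indepSets k (m + j)).filter (fun R => truncate m R = S), g ω R := by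
    intro ω
    obtain ⟨K, hK, z', hz', hsum⟩ := exists_effective_field (m := m) hlam j 0 1 (boundaryField ω)
      le_rfl (hb0 ω) fun x _ => boundaryField_mem ω x
    rw [hg]
    simp only
    rw [← Finset.sum_div, ← Finset.sum_div, hsum S hS, hsum ∅ (empty_mem_indepSets k m),
      weight_empty, mul_one, ← mul_div_assoc, mul_comm _ K]
    refine div_le_div_of_nonneg_right (mul_le_mul_of_nonneg_left ?_ hK)
      (sum_weight_pos hlam.le fun x _ => hb0 ω x).le
    refine weight_mono hlam.le (fun _ _ => hl0) (fun x hx => (hz' x ?_).2) S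
    rintro rfl
    rw [depth_one] at hx
    omega
  have main : ENNReal.ofReal (weight lam m (fun _ => l) S) * ν (cyl m ∅) ≤ ν (cyl m S) := by
    rw [hint, hint, ← lintegral_const_mul' _ _ ENNReal.ofReal_ne_top]
    refine lintegral_mono fun ω => ?_
    rw [← ENNReal.ofReal_mul hw0]
    exact ENNReal.ofReal_le_ofReal (hpt ω)
  have := ENNReal.toReal_mono (measure_ne_top ν _) main
  rwa [ENNReal.toReal_mul, ENNReal.toReal_ofReal hw0] at this

theorem IsGibbs.weight_mul_le_of_tendsto {k m : ℕ} {lam t : ℝ} (hlam : 0 < lam) (hm : 1 ≤ m)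
    (ht : Tendsto (fun j => ((boundMap k lam)^[j] (0, 1)).1) atTop (𝓝 t))
    {ν : Measure (Config k)} (hν : IsGibbs lam ν) {S : Finset (Vertex k)}
    (hS : S ∈ indepSets k m) :
    weight lam m (fun _ => t) S * ν.real (cyl m ∅) ≤ ν.real (cyl m S) := by
  have h1 : Tendsto (fun j => weight lam m (fun _ => ((boundMap k lam)^[j] (0, 1)).1) S *
      ν.real (cyl m ∅)) atTop (𝓝 (weight lam m (fun _ => t) S * ν.real (cyl m ∅))) :=
    Tendsto.mul_const _ (Tendsto.const_mul _ (tendsto_finsetProd _ fun _ _ => ht))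
  exact le_of_tendsto' h1 fun j => hν.weight_mul_le hlam hm j hS

theorem sum_real_cyl {k : ℕ} (n : ℕ) (μ : Measure (Config k)) [IsProbabilityMeasure μ] :
    ∑ S ∈ indepSets k n, μ.real (cyl n S) = 1 := by
  have := congrArg ENNReal.toReal (sum_measure_cyl n μ)
  rwa [ENNReal.toReal_sum fun _ _ => measure_ne_top _ _, ENNReal.toReal_one] at this

/-- A measure whose collection equals the extremal value on spheres of arbitrarily large radius is
an extreme Gibbs measure. -/
theorem CorrespondsTo.isExtremeGibbs {k : ℕ} {lam t : ℝ} (hlam : 0 < lam)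
    (ht : Tendsto (fun j => ((boundMap k lam)^[j] (0, 1)).1) atTop (𝓝 t))
    {z : Vertex k → ℝ} (hpos : ∀ x, 0 < z x)
    (hz : ∀ N, ∃ m, N ≤ m ∧ ∀ x, depth k x = m → z x = t)
    {μ : Measure (Config k)} (h : CorrespondsTo lam z μ) : IsExtremeGibbs lam μ := by
  refine ⟨h.isGibbs hlam hpos, ?_⟩
  rintro ν₁ hν₁ ν₂ hν₂ ⟨a, b, ha, hb, hab, hμ⟩
  have hG₁ : IsGibbs lam ν₁ := hν₁
  have hG₂ : IsGibbs lam ν₂ := hν₂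
  have := h.1
  have := hG₁.1
  have := hG₂.1
  refine measure_eq_of_cyl fun N => ?_
  obtain ⟨m, hNm, hzm⟩ := hz (N + 1)
  have hm : 1 ≤ m := by omega
  refine ⟨m, by omega, ?_⟩
  have hw : ∀ S : Finset (Vertex k), weight lam m z S = weight lam m (fun _ => t) S := fun S =>
    weight_congr lam S hzm
  have hconv : ∀ E, μ.real E = a * ν₁.real E + b * ν₂.real E := by
    intro E
    rw [← hμ, measureReal_def, Measure.add_apply, ENNReal.toReal_add (measure_ne_top _ _)
      (measure_ne_top _ _), Measure.smul_apply, Measure.smul_apply,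
      ENNReal.smul_def, ENNReal.smul_def, smul_eq_mul, smul_eq_mul, ENNReal.toReal_mul,
      ENNReal.toReal_mul]
    rfl
  have hμS : ∀ S ∈ indepSets k m, μ.real (cyl m S) = weight lam m z S * μ.real (cyl m ∅) := by
    intro S hS
    rw [h.real_cyl hlam hpos hm hS, h.real_cyl hlam hpos hm (empty_mem_indepSets k m),
      weight_empty]
    ring
  have ha' : (0 : ℝ) < a := ha
  have hb' : (0 : ℝ) < b := hb
  -- Both components obey the same lower bound, while their combination `μ` attains it because its
  -- field on `W_m` is `t`. As `a > 0`, `ν₁` attains it as well.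
  have hν₁S : ∀ S ∈ indepSets k m,
      ν₁.real (cyl m S) = weight lam m z S * ν₁.real (cyl m ∅) := by
    intro S hS
    have h1 := hG₁.weight_mul_le_of_tendsto hlam hm ht hS
    have h2 := hG₂.weight_mul_le_of_tendsto hlam hm ht hS
    rw [← hw] at h1 h2
    have h3 := hμS S hS
    rw [hconv, hconv] at h3
    refine le_antisymm ?_ h1
    have h4 := mul_le_mul_of_nonneg_left h2 hb'.le
    refine le_of_mul_le_mul_left ?_ ha'
    linarith
  -- Total mass one now fixes the probability of `∅`, and with it all cylinder probabilities on
  -- `V_m`.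
  have hsum := sum_real_cyl m ν₁
  rw [Finset.sum_congr rfl hν₁S, ← Finset.sum_mul] at hsum
  intro S hS
  rw [← measureReal_eq_measureReal_iff, hν₁S S hS, h.real_cyl hlam hpos hm hS,
    eq_one_div_of_mul_eq_one_right hsum]
  ring

/-! ### Collections with two values -/

theorem mem_evenSubgroup_iff_of_mem_children {k : ℕ} {x y : Vertex k} (h : y ∈ children k x) :
    y ∈ evenSubgroup k ↔ x ∉ evenSubgroup k := by
  rw [mem_evenSubgroup_iff_even_depth, mem_evenSubgroup_iff_even_depth, depth_of_mem_children h,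
    Nat.even_add_one]

theorem step_eq_fieldMap {k : ℕ} {lam t : ℝ} {z : Vertex k → ℝ} {x : Vertex k}
    (h : ∀ y ∈ children k x, z y = t) (hx : x ≠ 1) : step lam z x = fieldMap k lam t := by
  rw [step, Finset.prod_congr rfl fun y hy => by rw [h y hy], Finset.prod_const,
    card_children hx, fieldMap, inv_pow]

theorem step_twoValued_of_mem {k : ℕ} (lam u v : ℝ) {x : Vertex k} (hx : x ≠ 1)
    (h : x ∈ evenSubgroup k) : step lam (twoValued k u v) x = fieldMap k lam v :=
  step_eq_fieldMap (fun _ hy => if_neg fun h' => (mem_evenSubgroup_iff_of_mem_children hy).mp h' h) hx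

theorem step_twoValued_of_notMem {k : ℕ} (lam u v : ℝ) {x : Vertex k}
    (h : x ∉ evenSubgroup k) : step lam (twoValued k u v) x = fieldMap k lam u :=
  step_eq_fieldMap (fun _ hy => if_pos ((mem_evenSubgroup_iff_of_mem_children hy).mpr h)) fun h1 =>
    h (h1 ▸ one_mem _)

theorem twoValued_pos {k : ℕ} {u v : ℝ} (hu : 0 < u) (hv : 0 < v) (x : Vertex k) :
    0 < twoValued k u v x := by
  rw [twoValued]
  split_ifs <;> assumption

theorem gen_notMem_evenSubgroup {k : ℕ} (i : Fin (k + 1)) : gen k i ∉ evenSubgroup k := by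
  have h : upward k 1 ≠ some i := by
    rw [upward_eq_none_iff.mpr rfl]
    simp
  have h1 := depth_mul_gen_of_ne h
  rw [one_mul, depth_one] at h1
  rw [mem_evenSubgroup_iff_even_depth, h1]
  decide

theorem mul_gen_mem_evenSubgroup {k : ℕ} {x : Vertex k} (i : Fin (k + 1))
    (h : x ∉ evenSubgroup k) : x * gen k i ∈ evenSubgroup k := by
  have h2 : ∀ a b : Multiplicative (ZMod 2), a ≠ 1 → b ≠ 1 → a * b = 1 := by decide
  have hi := gen_notMem_evenSubgroup i
  rw [evenSubgroup, MonoidHom.mem_ker] at h hi ⊢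
  rw [map_mul]
  exact h2 _ _ h hi

theorem isPeriodic_twoValued (k : ℕ) (u v : ℝ) : IsPeriodic (evenSubgroup k) (twoValued k u v) := by
  intro x y hy
  rw [twoValued, twoValued]
  exact if_congr ((evenSubgroup k).mul_mem_cancel_left hy) rfl rfl

/-- The subgroup has two cosets, represented by `1` and a generator. -/
theorem IsPeriodic.eq_twoValued {k : ℕ} {z : Vertex k → ℝ} (h : IsPeriodic (evenSubgroup k) z) :
    z = twoValued k (z 1) (z (gen k 0)) := by
  funext x
  rw [twoValued]
  split_ifs with hx
  · simpa using h 1 x hx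
  · have := h (gen k 0) _ (mul_gen_mem_evenSubgroup 0 hx)
    rw [mul_assoc, gen_mul_self, mul_one] at this
    exact this

theorem isPeriodic_top_iff {k : ℕ} {z : Vertex k → ℝ} : IsPeriodic ⊤ z ↔ ∀ x, z x = z 1 :=
  ⟨fun h x => by simpa using h 1 x trivial, fun h x y _ => by rw [h (y * x), h x]⟩

/-- The measure does not see the collection at the root, so another even vertex must stand in for it
when the even value is recovered. -/
theorem exists_mem_evenSubgroup_ne_one {k : ℕ} (hk : 1 ≤ k) :
    ∃ x : Vertex k, x ≠ 1 ∧ x ∈ evenSubgroup k := by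
  have h01 : (0 : Fin (k + 1)) ≠ Fin.last k := by
    intro h
    have := congrArg Fin.val h
    simp at this
    omega
  refine ⟨gen k 0 * gen k (Fin.last k), fun h => h01 (gen_injective k ?_),
    mul_gen_mem_evenSubgroup _ (gen_notMem_evenSubgroup 0)⟩
  rw [← gen_inv k (Fin.last k)]
  exact eq_inv_of_mul_eq_one_left h

theorem exists_correspondsTo_twoValued {k : ℕ} {lam u v : ℝ} (hlam : 0 < lam) (hu : 0 < u)
    (hv : 0 < v) (huv : u = fieldMap k lam v) (hvu : v = fieldMap k lam u) :
    ∃ μ : Measure (Config k), CorrespondsTo lam (twoValued k u v) μ := by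
  refine exists_correspondsTo hlam (twoValued_pos hu hv) fun x hx => ?_
  by_cases h : x ∈ evenSubgroup k
  · rw [step_twoValued_of_mem lam u v hx h, twoValued, if_pos h, huv]
  · rw [step_twoValued_of_notMem lam u v h, twoValued, if_neg h, hvu]

/-- The collection of a periodic measure solves the system of equations. -/
theorem CorrespondsTo.eq_fieldMap {k : ℕ} (hk : 1 ≤ k) {lam u v : ℝ} (hlam : 0 < lam) (hu : 0 < u)
    (hv : 0 < v) {μ : Measure (Config k)} (h : CorrespondsTo lam (twoValued k u v) μ) :
    u = fieldMap k lam v ∧ v = fieldMap k lam u := by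
  obtain ⟨x, hx, hxe⟩ := exists_mem_evenSubgroup_ne_one hk
  have h1 := h.eq_step hlam (twoValued_pos hu hv) hx
  have h2 := h.eq_step hlam (twoValued_pos hu hv) (gen_ne_one k 0)
  rw [step_twoValued_of_mem lam u v hx hxe, twoValued, if_pos hxe] at h1
  rw [step_twoValued_of_notMem lam u v (gen_notMem_evenSubgroup 0), twoValued,
    if_neg (gen_notMem_evenSubgroup 0)] at h2
  exact ⟨h1, h2⟩

theorem CorrespondsTo.eq_and_eq {k : ℕ} (hk : 1 ≤ k) {lam u v : ℝ} (hlam : 0 < lam) (hu : 0 < u)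
    (hv : 0 < v) {μ : Measure (Config k)} (h : CorrespondsTo lam (twoValued k u v) μ)
    {z : Vertex k → ℝ} (hz : ∀ x, 0 < z x) (hzp : IsPeriodic (evenSubgroup k) z)
    (h' : CorrespondsTo lam z μ) : z 1 = u ∧ z (gen k 0) = v := by
  obtain ⟨x, hx, hxe⟩ := exists_mem_evenSubgroup_ne_one hk
  have h1 := h'.eq_of_ne_one hlam hz (twoValued_pos hu hv) h hx
  have h2 := h'.eq_of_ne_one hlam hz (twoValued_pos hu hv) h (gen_ne_one k 0)
  rw [twoValued, if_pos hxe] at h1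
  rw [twoValued, if_neg (gen_notMem_evenSubgroup 0)] at h2
  refine ⟨?_, h2⟩
  rw [← h1]
  simpa using (hzp 1 x hxe).symm

theorem CorrespondsTo.not_isTranslationInvariant {k : ℕ} (hk : 1 ≤ k) {lam u v : ℝ}
    (hlam : 0 < lam) (hu : 0 < u) (hv : 0 < v) (huv : u ≠ v) {μ : Measure (Config k)}
    (h : CorrespondsTo lam (twoValued k u v) μ) : ¬ IsTranslationInvariant lam μ := by
  rintro ⟨z, hz, hzp, hμ⟩
  obtain ⟨h1, h2⟩ := h.eq_and_eq hk hlam hu hv hz (fun x y _ => hzp x y trivial) hμ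
  rw [isPeriodic_top_iff] at hzp
  exact huv (h1.symm.trans ((hzp _).symm.trans h2))

theorem exists_depth_parity (N : ℕ) : (∃ m, N ≤ m ∧ Even m) ∧ ∃ m, N ≤ m ∧ ¬ Even m :=
  ⟨⟨2 * N, by omega, even_two_mul N⟩, 2 * N + 1, by omega, by simp⟩

/-- The extremal value is needed only on arbitrarily large spheres: here those of even radius, in
the companion those of odd radius. -/
theorem CorrespondsTo.isExtremeGibbs_left {k : ℕ} {lam u v : ℝ} (hlam : 0 < lam) (hu : 0 < u)
    (hv : 0 < v) (ht : Tendsto (fun j => ((boundMap k lam)^[j] (0, 1)).1) atTop (𝓝 u))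
    {μ : Measure (Config k)} (h : CorrespondsTo lam (twoValued k u v) μ) :
    IsExtremeGibbs lam μ :=
  h.isExtremeGibbs hlam ht (twoValued_pos hu hv) fun N =>
    (exists_depth_parity N).1.imp fun _ hm => ⟨hm.1, fun _ hx =>
      if_pos (mem_evenSubgroup_iff_even_depth.mpr (hx ▸ hm.2))⟩

theorem CorrespondsTo.isExtremeGibbs_right {k : ℕ} {lam u v : ℝ} (hlam : 0 < lam) (hu : 0 < u)
    (hv : 0 < v) (ht : Tendsto (fun j => ((boundMap k lam)^[j] (0, 1)).1) atTop (𝓝 v))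
    {μ : Measure (Config k)} (h : CorrespondsTo lam (twoValued k u v) μ) :
    IsExtremeGibbs lam μ :=
  h.isExtremeGibbs hlam ht (twoValued_pos hu hv) fun N =>
    (exists_depth_parity N).2.imp fun _ hm => ⟨hm.1, fun _ hx =>
      if_neg fun h' => hm.2 (hx ▸ mem_evenSubgroup_iff_even_depth.mp h')⟩

/-- If `(u, v)` is the only solution of the system with `u < v`, then the lower bounds for the
boundary fields converge to `u`. -/
theorem tendsto_boundMap {k : ℕ} {lam u v : ℝ} (hlam : 0 < lam) (hu : 0 < u)
    (huv : u < v) (hu' : u = fieldMap k lam v) (hv' : v = fieldMap k lam u)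
    (huniq : ∀ s t, 0 < s → s < t → s = fieldMap k lam t → t = fieldMap k lam s → s = u) :
    Tendsto (fun j => ((boundMap k lam)^[j] (0, 1)).1) atTop (𝓝 u) := by
  set p : ℕ → ℝ × ℝ := fun j => (boundMap k lam)^[j] (0, 1) with hp
  have hsucc : ∀ j, p (j + 1) = (fieldMap k lam (p j).2, fieldMap k lam (p j).1) := fun j =>
    Function.iterate_succ_apply' _ _ _
  have hone : fieldMap k lam 0 = 1 := by simp [fieldMap]
  -- The bounds always enclose `[u, v]`, which keeps them from merging at the symmetric solution.
  have hbd : ∀ j, 0 ≤ (p j).1 ∧ (p j).1 ≤ u ∧ v ≤ (p j).2 := by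
    intro j
    induction j with
    | zero =>
      refine ⟨le_rfl, hu.le, ?_⟩
      change v ≤ 1
      rw [hv', ← hone]
      exact fieldMap_anti k hlam le_rfl hu.le
    | succ j ih =>
      obtain ⟨h1, h2, h3⟩ := ih
      rw [hsucc]
      refine ⟨(fieldMap_pos k hlam ((hu.trans huv).le.trans h3)).le, ?_, ?_⟩
      · simp only
        conv_rhs => rw [hu']
        exact fieldMap_anti k hlam (hu.trans huv).le h3
      · simp only
        conv_lhs => rw [hv']
        exact fieldMap_anti k hlam h1 h2
  have hmono : ∀ j, (p j).1 ≤ (p (j + 1)).1 ∧ (p (j + 1)).2 ≤ (p j).2 := by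
    intro j
    induction j with
    | zero =>
      refine ⟨(hbd 1).1, ?_⟩
      rw [hsucc]
      exact hone.le
    | succ j ih =>
      rw [hsucc (j + 1)]
      have h1 := hsucc j
      have h2 : (p (j + 1)).1 = fieldMap k lam (p j).2 := by rw [h1]
      have h3 : (p (j + 1)).2 = fieldMap k lam (p j).1 := by rw [h1]
      constructor
      · rw [h2]
        exact fieldMap_anti k hlam ((hu.trans huv).le.trans (hbd (j + 1)).2.2) ih.2
      · rw [h3]
        exact fieldMap_anti k hlam (hbd j).1 ih.1
  have hl := tendsto_atTop_ciSup (monotone_nat_of_le_succ fun j => (hmono j).1)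
    ⟨u, by rintro _ ⟨j, rfl⟩; exact (hbd j).2.1⟩
  have hr := tendsto_atTop_ciInf (antitone_nat_of_succ_le fun j => (hmono j).2)
    ⟨v, by rintro _ ⟨j, rfl⟩; exact (hbd j).2.2⟩
  set s := ⨆ j, (p j).1
  set t := ⨅ j, (p j).2
  have hs0 : 0 ≤ s := ge_of_tendsto' hl fun j => (hbd j).1
  have hsu : s ≤ u := le_of_tendsto' hl fun j => (hbd j).2.1
  have hvt : v ≤ t := ge_of_tendsto' hr fun j => (hbd j).2.2
  have hcont : ∀ {w : ℝ}, 0 ≤ w → ContinuousAt (fieldMap k lam) w := by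
    intro w hw
    have : (1 + lam * w) ^ k ≠ 0 := by positivity
    exact ContinuousAt.inv₀ (by fun_prop) this
  have ht0 : 0 ≤ t := (hu.trans huv).le.trans hvt
  have hs : s = fieldMap k lam t := by
    refine tendsto_nhds_unique ((tendsto_add_atTop_iff_nat 1).mpr hl) ?_
    simp_rw [hsucc]
    exact (hcont ht0).tendsto.comp hr
  have ht : t = fieldMap k lam s := by
    refine tendsto_nhds_unique ((tendsto_add_atTop_iff_nat 1).mpr hr) ?_
    simp_rw [hsucc]
    exact (hcont hs0).tendsto.comp hl
  have hspos : 0 < s := hs ▸ fieldMap_pos k hlam ht0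
  -- Since `s ≤ u < v ≤ t`, the limit pair is an asymmetric solution and uniqueness applies.
  rw [← huniq s t hspos (hsu.trans_lt (huv.trans_le hvt)) hs ht]
  exact hl

/-! ### The explicit solution -/

/-- Cardano: with `w = a - 1/3` the left side `a³ - a²` is `w³ - w/3 - 2/27`, and `w = U/6 + 2/(3U)`
has summands of product `1/9`. What remains is a quadratic in `U³ = B/λ`, satisfied by the choice of
`B`. -/
theorem cardanoRoot_cubic {lam : ℝ} (hlam : 0 < lam) :
    cardanoRoot lam ^ 3 - cardanoRoot lam ^ 2 - 1 / lam = 0 := by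
  set B := 12 * √(12 * lam + 81) + 8 * lam + 108 with hB
  have hBpos : 0 < B := by positivity
  have hsq : √(12 * lam + 81) ^ 2 = 12 * lam + 81 := Real.sq_sqrt (by positivity)
  have hquad : B ^ 2 + 64 * lam ^ 2 - (16 * lam + 216) * B = 0 := by
    rw [hB]
    linear_combination 144 * hsq
  set U := (B / lam) ^ (1 / 3 : ℝ) with hU
  have hUpos : 0 < U := by positivity
  have hU3 : U ^ 3 = B / lam := by
    rw [hU, ← Real.rpow_natCast, ← Real.rpow_mul (by positivity)]
    norm_num
  have hinv : (lam / B) ^ (1 / 3 : ℝ) = U⁻¹ := by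
    rw [hU, ← Real.inv_rpow (by positivity), inv_div]
  have ha : cardanoRoot lam = 1 / 6 * U + 2 / 3 * U⁻¹ + 1 / 3 := by
    rw [cardanoRoot, ← hB, ← hU, hinv]
  have hexp : cardanoRoot lam ^ 3 - cardanoRoot lam ^ 2 =
      U ^ 3 / 216 + 8 / (27 * U ^ 3) - 2 / 27 := by
    rw [ha]
    field_simp
    ring
  rw [hexp, hU3]
  field_simp
  linear_combination 27 * hquad

theorem cardanoRoot_pos {lam : ℝ} (hlam : 0 < lam) : 0 < cardanoRoot lam := by
  rw [cardanoRoot]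
  positivity

/-- Uniqueness of the positive root of `s³ - s² = 1/λ`. -/
theorem eq_of_cubic {s t c : ℝ} (hc : 0 < c) (hs : 0 < s) (ht : 0 < t) (h1 : s ^ 3 - s ^ 2 = c)
    (h2 : t ^ 3 - t ^ 2 = c) : s = t := by
  -- Roots above `1` make the cofactor of `s - t` in `hfac` positive.
  have key : ∀ {s : ℝ}, 0 < s → s ^ 3 - s ^ 2 = c → 1 < s := by
    intro s hs h
    by_contra hle
    push Not at hle
    nlinarith [mul_nonneg (sq_nonneg s) (sub_nonneg.mpr hle)]
  have hs1 := key hs h1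
  have ht1 := key ht h2
  have hfac : (s - t) * (s * (s - 1) + t * (t - 1) + s * t) = 0 := by linear_combination h1 - h2
  rcases mul_eq_zero.mp hfac with h | h
  · linarith
  · have := mul_pos hs (sub_pos.mpr hs1)
    have := mul_pos ht (sub_pos.mpr ht1)
    have := mul_pos hs ht
    linarith

/-- `3 < λ a²`, that is, the quadratic equation for the roots of `z₁` and `z₂` has two solutions. -/
theorem three_lt_mul_sq {lam a : ℝ} (hlam : 27 / 16 < lam) (ha : 0 < a)
    (h : a ^ 3 - a ^ 2 - 1 / lam = 0) : 3 < lam * a ^ 2 := by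
  have hlam0 : 0 < lam := by linarith
  have h1 : lam * a ^ 2 * (a - 1) = 1 := by
    field_simp at h
    linear_combination h
  -- At `λ = 27/16` the root is `4/3`. As `λa² = 1/(a - 1)`, the claim `λa² > 3` amounts to `a <
  -- 4/3`.
  have h43 : a < 4 / 3 := by
    by_contra hle
    push Not at hle
    have h2 : 16 / 9 ≤ a ^ 2 := by nlinarith
    have h3 : 3 < lam * a ^ 2 := by nlinarith
    nlinarith
  by_contra hle
  push Not at hle
  nlinarith [mul_pos hlam0 (pow_pos ha 2)]

/-- The cube roots `x < y` of `z₁` and `z₂` satisfy `x + y = a` and `x y = 1 / (λ a)`. -/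
theorem exists_cube_roots {lam : ℝ} (hlam : 27 / 16 < lam) :
    ∃ x y : ℝ, 0 < x ∧ x < y ∧ x + y = cardanoRoot lam ∧
      lam * (x * y * cardanoRoot lam) = 1 ∧ zOne lam = x ^ 3 ∧ zTwo lam = y ^ 3 := by
  have hlam0 : 0 < lam := by linarith
  have ha := cardanoRoot_pos hlam0
  have hc := cardanoRoot_cubic hlam0
  have h3 := three_lt_mul_sq hlam ha hc
  rw [zOne, zTwo]
  set a := cardanoRoot lam
  have hc' : lam * a ^ 3 = lam * a ^ 2 + 1 := by
    field_simp at hc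
    linear_combination hc
  -- The discriminant is `λa(λa³ - 4)`, and the cubic gives `λa³ = λa² + 1 > 4`.
  have hD : 0 < lam ^ 2 * a ^ 4 - 4 * lam * a := by
    have : 0 < lam * a * (lam * a ^ 3 - 4) := mul_pos (mul_pos hlam0 ha) (by linarith)
    linarith
  set D := √(lam ^ 2 * a ^ 4 - 4 * lam * a) with hDdef
  have hDpos : 0 < D := Real.sqrt_pos.mpr hD
  have hD2 : D ^ 2 = lam ^ 2 * a ^ 4 - 4 * lam * a := Real.sq_sqrt hD.le
  have hla : 0 < lam * a := mul_pos hlam0 ha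
  have hlt : D < lam * a ^ 2 := by
    refine lt_of_pow_lt_pow_left₀ 2 (by positivity) ?_
    rw [hD2]
    linarith
  refine ⟨_, _, ?_, ?_, ?_, ?_, rfl, rfl⟩
  · exact div_pos (by linarith) (by linarith)
  · exact div_lt_div_of_pos_right (by linarith) (by linarith)
  · field_simp
    ring
  · field_simp
    linear_combination -hD2

/-- After multiplication by `a`, the relation `λxya = 1` reduces the claim to `xa + y² = a`, that is
`a² - xy = a`, which is the cubic. -/
theorem mul_cube_eq_one {lam a x y : ℝ} (hlam : 0 < lam) (ha : 0 < a)
    (hc : a ^ 3 - a ^ 2 - 1 / lam = 0) (hsum : x + y = a) (hprod : lam * (x * y * a) = 1) :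
    x * (1 + lam * y ^ 3) = 1 := by
  have hc' : lam * a ^ 3 = lam * a ^ 2 + 1 := by
    field_simp at hc
    linear_combination hc
  have h1 : a * (x * (1 + lam * y ^ 3)) = a * 1 := by
    have h2 : a * (x * (1 + lam * y ^ 3)) = a * x + y ^ 2 := by
      linear_combination y ^ 2 * hprod
    have h3 : lam * a * (x * a + y ^ 2) = lam * a * a := by
      have hx : x = a - y := by linarith
      rw [hx] at hprod ⊢
      linear_combination hc' - hprod
    have h4 := mul_left_cancel₀ (mul_pos hlam ha).ne' h3
    linarith
  exact mul_left_cancel₀ ha.ne' h1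

theorem fieldMap_three_of_mul_eq_one {lam x y : ℝ} (h : x * (1 + lam * y ^ 3) = 1) :
    fieldMap 3 lam (y ^ 3) = x ^ 3 := by
  rw [fieldMap, ← inv_pow, ← eq_inv_of_mul_eq_one_left h]

/-- A solution of the system with `s < t` is a pair of cubes with sum `a`. -/
theorem eq_zOne_and_eq_zTwo {lam s t : ℝ} (hlam : 27 / 16 < lam) (hs : 0 < s) (hst : s < t)
    (h1 : s = fieldMap 3 lam t) (h2 : t = fieldMap 3 lam s) : s = zOne lam ∧ t = zTwo lam := by
  have hlam0 : 0 < lam := by linarith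
  have ht := hs.trans hst
  obtain ⟨x, y, hx, hxy, hsum, hprod, hz1, hz2⟩ := exists_cube_roots hlam
  have ha := cardanoRoot_pos hlam0
  have hc := cardanoRoot_cubic hlam0
  set p := (1 + lam * t)⁻¹ with hp
  set q := (1 + lam * s)⁻¹ with hq
  have hp0 : 0 < p := by positivity
  have hq0 : 0 < q := by positivity
  have hsp : s = p ^ 3 := by rw [hp, inv_pow]; exact h1
  have htq : t = q ^ 3 := by rw [hq, inv_pow]; exact h2
  have hpe : p * (1 + lam * q ^ 3) = 1 := by
    rw [← htq]
    exact inv_mul_cancel₀ (one_add_mul_pos hlam0 ht.le).ne'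
  have hqe : q * (1 + lam * p ^ 3) = 1 := by
    rw [← hsp]
    exact inv_mul_cancel₀ (one_add_mul_pos hlam0 hs.le).ne'
  have hpq : p < q := by
    rw [hsp, htq] at hst
    exact lt_of_pow_lt_pow_left₀ 3 hq0.le hst
  -- The difference of the two equations has the nonzero factor `p - q`.
  have hpqs : lam * (p * q * (p + q)) = 1 := by
    have : (p - q) * (1 - lam * (p * q * (p + q))) = 0 := by linear_combination hpe - hqe
    rcases mul_eq_zero.mp this with h | h <;> linarith
  -- The equations give `p² + pq + q² = p + q`; eliminating `pq` leaves the cubic for the sum.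
  have hcub : (p + q) ^ 3 - (p + q) ^ 2 = 1 / lam := by
    have h3 : p * (p + q) + q ^ 2 = p + q := by
      linear_combination (p + q) * hpe - q ^ 2 * hpqs
    field_simp
    linear_combination lam * (p + q) * h3 + hpqs
  have hsum' : p + q = cardanoRoot lam :=
    eq_of_cubic (one_div_pos.mpr hlam0) (add_pos hp0 hq0) ha hcub (by linarith)
  rw [hsum'] at hpqs
  have hmul : p * q = x * y :=
    mul_right_cancel₀ ha.ne' (mul_left_cancel₀ hlam0.ne' (hpqs.trans hprod.symm))
  -- The pairs have equal sum and product, so they agree up to order; `p < q` and `x < y` settle the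
  -- order.
  have hfac : (p - x) * (p - y) = 0 := by
    have : q = x + y - p := by linarith
    rw [this] at hmul
    linear_combination -hmul
  have hpx : p = x := by
    rcases mul_eq_zero.mp hfac with h | h
    · linarith
    · linarith
  have hqy : q = y := by linarith
  rw [hsp, htq, hz1, hz2, hpx, hqy]
  exact ⟨rfl, rfl⟩

end HardCore

end

/-! ### The case `k = 3`: inequality, classification and extremality. -/

theorem mainTheorem2 (lam : ℝ) (hlam : 27 / 16 < lam) :
    -- `a` is the root of the cubic, and `(z₁, z₂)` is a positive asymmetric solution of the system
    HardCore.cardanoRoot lam ^ 3 - HardCore.cardanoRoot lam ^ 2 - 1 / lam = 0 ∧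
    0 < HardCore.zOne lam ∧ HardCore.zOne lam < HardCore.zTwo lam ∧
    HardCore.zOne lam = 1 / (1 + lam * HardCore.zTwo lam) ^ 3 ∧
    HardCore.zTwo lam = 1 / (1 + lam * HardCore.zOne lam) ^ 3 ∧
    -- the inequality `g(λ) < 0`
    9 * (lam ^ 2 * HardCore.zOne lam * HardCore.zTwo lam /
        ((1 + lam * HardCore.zOne lam) * (1 + lam * HardCore.zTwo lam))) * (lam / (lam + 1)) - 1
      < 0 ∧
    -- the measures exist, are exactly the non-translation-invariant periodic ones, and are extreme
    ∃ μ₁ μ₂ : MeasureTheory.Measure (HardCore.Config 3),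
      HardCore.CorrespondsTo lam
        (HardCore.twoValued 3 (HardCore.zOne lam) (HardCore.zTwo lam)) μ₁ ∧
      HardCore.CorrespondsTo lam
        (HardCore.twoValued 3 (HardCore.zTwo lam) (HardCore.zOne lam)) μ₂ ∧
      μ₁ ≠ μ₂ ∧
      {μ : MeasureTheory.Measure (HardCore.Config 3) |
          HardCore.IsPeriodicMeasure lam (HardCore.evenSubgroup 3) μ ∧
          ¬ HardCore.IsTranslationInvariant lam μ} = {μ₁, μ₂} ∧
      HardCore.IsGibbs lam μ₁ ∧ HardCore.IsGibbs lam μ₂ ∧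
      HardCore.IsExtremeGibbs lam μ₁ ∧ HardCore.IsExtremeGibbs lam μ₂ := by
  have hlam0 : 0 < lam := by linarith
  have ha := HardCore.cardanoRoot_pos hlam0
  have hc := HardCore.cardanoRoot_cubic hlam0
  have h3 := HardCore.three_lt_mul_sq hlam ha hc
  obtain ⟨x, y, hx, hxy, hsum, hprod, hz1, hz2⟩ := HardCore.exists_cube_roots hlam
  have hy := hx.trans hxy
  have hxe := HardCore.mul_cube_eq_one hlam0 ha hc hsum hprod
  have hye := HardCore.mul_cube_eq_one hlam0 ha hc ((add_comm y x).trans hsum)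
    (by rw [mul_comm y x]; exact hprod)
  have hu : 0 < HardCore.zOne lam := hz1 ▸ pow_pos hx 3
  have huv : HardCore.zOne lam < HardCore.zTwo lam := by
    rw [hz1, hz2]
    exact pow_lt_pow_left₀ hxy hx.le (by norm_num)
  have hv := hu.trans huv
  have hu' : HardCore.zOne lam = HardCore.fieldMap 3 lam (HardCore.zTwo lam) := by
    rw [hz1, hz2, HardCore.fieldMap_three_of_mul_eq_one hxe]
  have hv' : HardCore.zTwo lam = HardCore.fieldMap 3 lam (HardCore.zOne lam) := by
    rw [hz1, hz2, HardCore.fieldMap_three_of_mul_eq_one hye]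
  have ht := HardCore.tendsto_boundMap hlam0 hu huv hu' hv' fun s t hs hst h1 h2 =>
    (HardCore.eq_zOne_and_eq_zTwo hlam hs hst h1 h2).1
  have hg : 9 * (lam ^ 2 * HardCore.zOne lam * HardCore.zTwo lam /
        ((1 + lam * HardCore.zOne lam) * (1 + lam * HardCore.zTwo lam))) * (lam / (lam + 1)) - 1
      < 0 := by
    -- Here `1/(1 + λz₂) = x` and `1/(1 + λz₁) = y`, so the quotient is `λ²x³y³ · xy`.
    have h1 : lam ^ 2 * HardCore.zOne lam * HardCore.zTwo lam /
        ((1 + lam * HardCore.zOne lam) * (1 + lam * HardCore.zTwo lam)) =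
        lam ^ 2 * (x * y) ^ 4 := by
      rw [hz1, hz2, div_eq_iff (by positivity)]
      linear_combination (-(lam ^ 2 * x ^ 3 * y ^ 3)) * hxe
        - lam ^ 2 * x ^ 3 * y ^ 3 * (x * (1 + lam * y ^ 3)) * hye
    -- By `λxya = 1` the quotient equals `1/(λ²a⁴)`, which is below `1/9` because `λa² > 3`.
    have h2 : 9 < lam ^ 2 * HardCore.cardanoRoot lam ^ 4 := by nlinarith
    have hpos : 0 < lam ^ 2 * (x * y) ^ 4 := by positivity
    have h4 : lam ^ 2 * (x * y) ^ 4 * (lam ^ 2 * HardCore.cardanoRoot lam ^ 4) = 1 := by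
      have : lam ^ 2 * (x * y) ^ 4 * (lam ^ 2 * HardCore.cardanoRoot lam ^ 4) =
        (lam * (x * y * HardCore.cardanoRoot lam)) ^ 4 := by ring
      rw [this, hprod, one_pow]
    have h5 : lam ^ 2 * (x * y) ^ 4 * 9 < 1 := by
      rw [← h4]
      exact mul_lt_mul_of_pos_left h2 hpos
    have h6 : lam / (lam + 1) < 1 := (div_lt_one (by linarith)).mpr (by linarith)
    have h7 : 0 < lam / (lam + 1) := by positivity
    rw [h1]
    nlinarith
  refine ⟨hc, hu, huv, by rw [one_div]; exact hu', by rw [one_div]; exact hv', hg, ?_⟩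
  obtain ⟨μ₁, hμ₁⟩ := HardCore.exists_correspondsTo_twoValued hlam0 hu hv hu' hv'
  obtain ⟨μ₂, hμ₂⟩ := HardCore.exists_correspondsTo_twoValued hlam0 hv hu hv' hu'
  have hk : 1 ≤ 3 := by norm_num
  refine ⟨μ₁, μ₂, hμ₁, hμ₂, ?_, ?_, hμ₁.isGibbs hlam0 (HardCore.twoValued_pos hu hv),
    hμ₂.isGibbs hlam0 (HardCore.twoValued_pos hv hu), hμ₁.isExtremeGibbs_left hlam0 hu hv ht,
    hμ₂.isExtremeGibbs_right hlam0 hv hu ht⟩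
  · rintro rfl
    obtain ⟨h1, _⟩ := hμ₁.eq_and_eq hk hlam0 hu hv (HardCore.twoValued_pos hv hu)
      (HardCore.isPeriodic_twoValued 3 _ _) hμ₂
    rw [HardCore.twoValued, if_pos (one_mem _)] at h1
    exact huv.ne' h1
  · ext μ
    constructor
    · rintro ⟨⟨z, hz, hzp, hμ⟩, hti⟩
      have hz2 := hzp.eq_twoValued
      have hμ' := hμ
      rw [hz2] at hμ'
      obtain ⟨h1, h2⟩ := hμ'.eq_fieldMap hk hlam0 (hz _) (hz _)
      -- Equal values would make the measure translation-invariant; the two strict orders give `μ₁`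
      -- and `μ₂`.
      rcases lt_trichotomy (z 1) (z (HardCore.gen 3 0)) with h | h | h
      · obtain ⟨h4, h5⟩ := HardCore.eq_zOne_and_eq_zTwo hlam (hz _) h h1 h2
        rw [h4, h5] at hμ'
        exact Or.inl (HardCore.correspondsTo_unique hμ' hμ₁)
      · refine absurd ⟨z, hz, HardCore.isPeriodic_top_iff.mpr fun x => ?_, hμ⟩ hti
        rw [hz2, ← h]
        simp [HardCore.twoValued]
      · obtain ⟨h4, h5⟩ := HardCore.eq_zOne_and_eq_zTwo hlam (hz _) h h2 h1
        rw [h4, h5] at hμ'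
        exact Or.inr (HardCore.correspondsTo_unique hμ' hμ₂)
    · rintro (rfl | rfl)
      · exact ⟨⟨_, HardCore.twoValued_pos hu hv, HardCore.isPeriodic_twoValued 3 _ _, hμ₁⟩,
          hμ₁.not_isTranslationInvariant hk hlam0 hu hv huv.ne⟩
      · exact ⟨⟨_, HardCore.twoValued_pos hv hu, HardCore.isPeriodic_twoValued 3 _ _, hμ₂⟩,
          hμ₂.not_isTranslationInvariant hk hlam0 hv hu huv.ne'⟩
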